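/- **Conventions.** A *conflation category* is an additive category with a class of kernel-cokernel pairs $X \xrightarrow{f} Y \xrightarrow{g} Z$, called *conflations*, closed under isomorphism; $f$ is then called an *inflation* and $g$ a *deflation*. It is an *exact category* if $X \to 0$ is always a deflation, deflations are closed under composition, pullbacks along deflations exist and deflations are stable under pullback, and the dual axioms hold for inflations. A morphism is *admissible* if it is a deflation followed by an inflation. An additive functor $\Phi$ between exact categories is *exact* if it maps conflations to conflations, and *left exact* if for each conflation $X \xrightarrow{f} Y \xrightarrow{g} Z$ the morphism $\Phi(f)$ is an inflation, $\Phi(g)$ is admissible, and $\Phi(f)$ is a kernel of $\Phi(g)$. For an exact category $\mathcal{E}$, let $\mathrm{mod}_{\mathrm{adm}}(\mathcal{E})$ be the full subcategory of the category of functors $\mathcal{E}^{\mathrm{op}} \to \mathrm{Ab}$ on those $F$ that admit an exact sequence $\mathrm{Hom}(-,X) \xrightarrow{\mathrm{Hom}(-,f)} \mathrm{Hom}(-,Y) \to F \to 0$ with $f \colon X \to Y$ admissible in $\mathcal{E}$; its conflations are the sequences that are short exact as sequences of functors. Let $\Upsilon \colon \mathcal{E} \to \mathrm{mod}_{\mathrm{adm}}(\mathcal{E})$,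 $A \mapsto \mathrm{Hom}_{\mathcal{E}}(-,A)$, be the Yoneda embedding. **Theorem.** Let $\mathcal{E}$ be an exact category. Then $\mathrm{mod}_{\mathrm{adm}}(\mathcal{E})$ is an exact category and: 1. The functor $\Upsilon \colon \mathcal{E} \to \mathrm{mod}_{\mathrm{adm}}(\mathcal{E})$ is left exact. 2. Let $\mathcal{F}$ be an exact category and $\Phi \colon \mathcal{E} \to \mathcal{F}$ a left exact functor. There exists an exact functor $\overline{\Phi} \colon \mathrm{mod}_{\mathrm{adm}}(\mathcal{E}) \to \mathcal{F}$ with $\overline{\Phi} \circ \Upsilon \cong \Phi$. It is unique up to isomorphism: if $\Psi, \Psi'$ are exact functors with isomorphisms $\alpha \colon \Psi\circ\Upsilon \cong \Phi$ and $\alpha' \colon \Psi'\circ\Upsilon \cong \Phi$, then there is a unique isomorphism $\beta \colon \Psi \cong \Psi'$ with $\alpha' \circ \beta_{\Upsilon} = \alpha$. If $\Upsilon$ is injective on objects, then $\overline{\Phi}$ can be chosen so that $\overline{\Phi} \circ \Upsilon = \Phi$. **Corollary.** Let $\mathrm{Ex}$ (respectively $\mathrm{Ex}_L$) be the 2-category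 whose objects are the essentially small exact categories, whose 1-morphisms are the exact (respectively left exact) functors and whose 2-morphisms are the natural transformations. The assignment $\mathcal{E} \mapsto \mathrm{mod}_{\mathrm{adm}}(\mathcal{E})$ on objects extends to a 2-functor (pseudofunctor) $\mathrm{mod}_{\mathrm{adm}}(-) \colon \mathrm{Ex}_L \to \mathrm{Ex}$ for which the Yoneda embeddings $\Upsilon \colon \mathcal{E} \to \mathrm{mod}_{\mathrm{adm}}(\mathcal{E})$ are the components of a pseudonatural transformation from the identity of $\mathrm{Ex}_L$ to the composite of $\mathrm{mod}_{\mathrm{adm}}(-)$ with the inclusion $\mathrm{Ex} \subseteq \mathrm{Ex}_L$. This 2-functor is left adjoint to the inclusion, i.e. for all $\mathcal{E} \in \mathrm{Ex}_L$ and $\mathcal{E}' \in \mathrm{Ex}$ restriction along $\Upsilon$ $$\mathrm{Hom}_{\mathrm{Ex}}(\mathrm{mod}_{\mathrm{adm}}(\mathcal{E}), \mathcal{E}') \to \mathrm{Hom}_{\mathrm{Ex}_L}(\mathcal{E}, \mathcal{E}')$$ is an equivalence of categories. -/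

import Mathlib

open CategoryTheory CategoryTheory.Limits

universe v u v' u' w

namespace AdmPres

/-! ### Conflation categories and exact categories -/

/-- A class of kernel-cokernel pairs ("conflations"), closed under isomorphism, on a preadditive
category. -/
class ConflationCategory (C : Type u) [Category.{v} C] [Preadditive C] where
  /-- `conf f g` says that `X ⟶ Y ⟶ Z`, with maps `f` and `g`, is a conflation. -/
  conf : ∀ {X Y Z : C}, (X ⟶ Y) → (Y ⟶ Z) → Prop
  zero : ∀ {X Y Z : C} {f : X ⟶ Y} {g : Y ⟶ Z}, conf f g → f ≫ g = 0
  kernel : ∀ {X Y Z : C} {f : X ⟶ Y} {g : Y ⟶ Z} (h : conf f g),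
    Nonempty (IsLimit (KernelFork.ofι f (zero h)))
  cokernel : ∀ {X Y Z : C} {f : X ⟶ Y} {g : Y ⟶ Z} (h : conf f g),
    Nonempty (IsColimit (CokernelCofork.ofπ g (zero h)))
  of_iso : ∀ {X Y Z X' Y' Z' : C} {f : X ⟶ Y} {g : Y ⟶ Z} {f' : X' ⟶ Y'} {g' : Y' ⟶ Z'}
    (a : X ≅ X') (b : Y ≅ Y') (c : Z ≅ Z'),
    f ≫ b.hom = a.hom ≫ f' → g ≫ c.hom = b.hom ≫ g' → conf f g → conf f' g'

section

variable {C : Type u} [Category.{v} C] [Preadditive C] [ConflationCategory C]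

/-- `f` is the kernel part of a conflation. -/
def IsInflation {X Y : C} (f : X ⟶ Y) : Prop :=
  ∃ (Z : C) (g : Y ⟶ Z), ConflationCategory.conf f g

/-- `g` is the cokernel part of a conflation. -/
def IsDeflation {Y Z : C} (g : Y ⟶ Z) : Prop :=
  ∃ (X : C) (f : X ⟶ Y), ConflationCategory.conf f g

/-- `f` is a deflation followed by an inflation. -/
def IsAdmissible {X Y : C} (f : X ⟶ Y) : Prop :=
  ∃ (I : C) (p : X ⟶ I) (i : I ⟶ Y), IsDeflation p ∧ IsInflation i ∧ p ≫ i = f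

end

/-- Exact categories in the sense of Quillen: additive categories with a class of conflations
subject to the axioms R0-R2 and their duals L0-L2. -/
class IsExactCategory (C : Type u) [Category.{v} C] [Preadditive C] [ConflationCategory C] :
    Prop extends HasFiniteBiproducts C where
  deflation_to_zero : ∀ {X Z : C} (g : X ⟶ Z), IsZero Z → IsDeflation g
  deflation_comp : ∀ {X Y Z : C} (f : X ⟶ Y) (g : Y ⟶ Z),
    IsDeflation f → IsDeflation g → IsDeflation (f ≫ g)
  hasPullback : ∀ {X Y Z : C} (f : X ⟶ Z) (g : Y ⟶ Z), IsDeflation g → HasPullback f g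
  deflation_pullback : ∀ {P X Y Z : C} {p : P ⟶ X} {q : P ⟶ Y} {f : X ⟶ Z} {g : Y ⟶ Z},
    IsPullback p q f g → IsDeflation g → IsDeflation p
  inflation_from_zero : ∀ {Z X : C} (f : Z ⟶ X), IsZero Z → IsInflation f
  inflation_comp : ∀ {X Y Z : C} (f : X ⟶ Y) (g : Y ⟶ Z),
    IsInflation f → IsInflation g → IsInflation (f ≫ g)
  hasPushout : ∀ {X Y Z : C} (f : Z ⟶ X) (g : Z ⟶ Y), IsInflation g → HasPushout f g
  inflation_pushout : ∀ {P X Y Z : C} {f : Z ⟶ X} {g : Z ⟶ Y} {p : X ⟶ P} {q : Y ⟶ P},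
    IsPushout f g p q → IsInflation g → IsInflation p

/-! ### Exact and left exact functors -/

section

variable {C : Type u} [Category.{v} C] [Preadditive C] [ConflationCategory C]
  {D : Type u'} [Category.{v'} D] [Preadditive D] [ConflationCategory D]

/-- Additive functors mapping conflations to conflations. -/
structure IsExactFunctor (F : C ⥤ D) : Prop where
  additive : F.Additive
  map_conf : ∀ {X Y Z : C} {f : X ⟶ Y} {g : Y ⟶ Z},
    ConflationCategory.conf f g → ConflationCategory.conf (F.map f) (F.map g)

/-- Additive functors mapping each conflation `X ⟶ Y ⟶ Z` to an exact sequence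
`0 ⟶ F X ⟶ F Y ⟶ F Z ⟶ coker ⟶ 0` with admissible maps: `F f` is an inflation, `F g` is
admissible, and `F f` is a kernel of `F g`. -/
structure IsLeftExactFunctor (F : C ⥤ D) : Prop where
  additive : F.Additive
  map_inflation : ∀ {X Y Z : C} {f : X ⟶ Y} {g : Y ⟶ Z},
    ConflationCategory.conf f g → IsInflation (F.map f)
  map_deflation : ∀ {X Y Z : C} {f : X ⟶ Y} {g : Y ⟶ Z},
    ConflationCategory.conf f g → IsAdmissible (F.map g)
  map_kernel : ∀ {X Y Z : C} {f : X ⟶ Y} {g : Y ⟶ Z},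
    ConflationCategory.conf f g →
      ∃ h : F.map f ≫ F.map g = 0, Nonempty (IsLimit (KernelFork.ofι (F.map f) h))

end

section

variable {C : Type u} [Category.{v} C] [Preadditive C] [ConflationCategory C]

lemma mono_of_isInflation {X Y : C} {f : X ⟶ Y} (hf : IsInflation f) : Mono f := by
  obtain ⟨Z, g, h⟩ := hf
  exact Fork.IsLimit.mono (ConflationCategory.kernel h).some

lemma isInflation_id [IsExactCategory C] (X : C) : IsInflation (𝟙 X) := by
  have : HasZeroObject C := hasZeroObject_of_hasFiniteBiproducts C
  obtain ⟨Z, hZ⟩ := this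
  obtain ⟨K, k, hk⟩ := IsExactCategory.deflation_to_zero (0 : X ⟶ Z) hZ
  have hl := (ConflationCategory.kernel hk).some
  have : Mono k := Fork.IsLimit.mono hl
  obtain ⟨l, hl'⟩ := KernelFork.IsLimit.lift' hl (𝟙 X) (by simp)
  have hl'' : l ≫ k = 𝟙 X := hl'
  let e : K ≅ X := ⟨k, l, by rw [← cancel_mono k, Category.assoc, hl'']; simp, hl''⟩
  exact ⟨Z, 0, ConflationCategory.of_iso e (Iso.refl X) (Iso.refl _) (by simp [e]) (by simp) hk⟩

lemma isDeflation_id [IsExactCategory C] (X : C) : IsDeflation (𝟙 X) := by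
  have : HasZeroObject C := hasZeroObject_of_hasFiniteBiproducts C
  obtain ⟨Z, hZ⟩ := this
  obtain ⟨K, k, hk⟩ := IsExactCategory.inflation_from_zero (0 : Z ⟶ X) hZ
  have hl := (ConflationCategory.cokernel hk).some
  have : Epi k := Cofork.IsColimit.epi hl
  obtain ⟨l, hl'⟩ := CokernelCofork.IsColimit.desc' hl (𝟙 X) (by simp)
  have hl'' : k ≫ l = 𝟙 X := hl'
  let e : K ≅ X := ⟨l, k, by rw [← cancel_epi k, reassoc_of% hl'']; simp, hl''⟩
  exact ⟨Z, 0, ConflationCategory.of_iso (Iso.refl _) (Iso.refl X) e (by simp)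
    (by simp [e, hl'']) hk⟩

lemma conf_of_isKernel {X Y Z : C} {f : X ⟶ Y} {g : Y ⟶ Z} (w : f ≫ g = 0)
    (hf : IsLimit (KernelFork.ofι f w)) (hg : IsDeflation g) : ConflationCategory.conf f g := by
  obtain ⟨K, k, hk⟩ := hg
  have hl := (ConflationCategory.kernel hk).some
  refine ConflationCategory.of_iso (hl.conePointUniqueUpToIso hf) (Iso.refl Y) (Iso.refl Z)
    ?_ (by simp) hk
  have := hl.conePointUniqueUpToIso_hom_comp hf WalkingParallelPair.zero
  simpa using this.symm

variable {D : Type u'} [Category.{v'} D] [Preadditive D] [ConflationCategory D]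

lemma IsExactFunctor.isLeftExactFunctor [IsExactCategory D] {F : C ⥤ D} (hF : IsExactFunctor F) :
    IsLeftExactFunctor F where
  additive := hF.additive
  map_inflation h := ⟨_, _, hF.map_conf h⟩
  map_deflation h := ⟨_, _, _, ⟨_, _, hF.map_conf h⟩, isInflation_id _, by simp⟩
  map_kernel h := ⟨_, ConflationCategory.kernel (hF.map_conf h)⟩

/-- A left exact functor takes a conflation to the kernel of an admissible map with explicit
factorisation. -/
lemma IsLeftExactFunctor.exists_conf {F : C ⥤ D} (hF : IsLeftExactFunctor F)
    {X Y Z : C} {f : X ⟶ Y} {g : Y ⟶ Z} (h : ConflationCategory.conf f g) :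
    ∃ (I : D) (p : F.obj Y ⟶ I) (i : I ⟶ F.obj Z), ConflationCategory.conf (F.map f) p ∧
      IsInflation i ∧ p ≫ i = F.map g := by
  obtain ⟨I, p, i, hp, hi, e⟩ := hF.map_deflation h
  obtain ⟨z, ⟨hl⟩⟩ := hF.map_kernel h
  have := mono_of_isInflation hi
  have := mono_of_isInflation (hF.map_inflation h)
  have w : F.map f ≫ p = 0 := by
    rw [← cancel_mono i, Category.assoc, e, z, zero_comp]
  refine ⟨I, p, i, conf_of_isKernel w ?_ hp, hi, e⟩
  refine KernelFork.IsLimit.ofι' _ _ fun {A} k hk => ?_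
  exact KernelFork.IsLimit.lift' hl k (by rw [← e, reassoc_of% hk, zero_comp])

end

section

variable {C : Type u} [Category.{v} C] [Preadditive C] [ConflationCategory C]

lemma IsExactFunctor.id : IsExactFunctor (𝟭 C) where
  additive := inferInstance
  map_conf h := h

variable {D : Type u} [Category.{v} D] [Preadditive D] [ConflationCategory D]
  {E : Type u} [Category.{v} E] [Preadditive E] [ConflationCategory E]

lemma IsExactFunctor.comp {F : C ⥤ D} {G : D ⥤ E} (hF : IsExactFunctor F)
    (hG : IsExactFunctor G) : IsExactFunctor (F ⋙ G) where
  additive := by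
    have := hF.additive
    have := hG.additive
    infer_instance
  map_conf h := hG.map_conf (hF.map_conf h)

lemma IsLeftExactFunctor.map_isInflation {F : C ⥤ D} (hF : IsLeftExactFunctor F) {X Y : C}
    {f : X ⟶ Y} (hf : IsInflation f) : IsInflation (F.map f) := by
  obtain ⟨_, _, h⟩ := hf
  exact hF.map_inflation h

lemma IsLeftExactFunctor.comp [IsExactCategory D] [IsExactCategory E] {F : C ⥤ D} {G : D ⥤ E}
    (hF : IsLeftExactFunctor F) (hG : IsLeftExactFunctor G) : IsLeftExactFunctor (F ⋙ G) where
  additive := by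
    have := hF.additive
    have := hG.additive
    infer_instance
  map_inflation h := hG.map_isInflation (hF.map_inflation h)
  map_deflation h := by
    obtain ⟨I, p, i, hp, hi, e⟩ := hF.exists_conf h
    obtain ⟨J, q, j, hq, hj, e'⟩ := hG.map_deflation hp
    exact ⟨J, q, j ≫ G.map i, hq,
      IsExactCategory.inflation_comp _ _ hj (hG.map_isInflation hi),
      by rw [← Category.assoc, e', ← G.map_comp, e]; rfl⟩
  map_kernel {X Y Z f g} h := by
    obtain ⟨I, p, i, hp, hi, e⟩ := hF.exists_conf h
    obtain ⟨z, ⟨hl⟩⟩ := hG.map_kernel hp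
    have := mono_of_isInflation (hG.map_isInflation hi)
    have e' : (F ⋙ G).map g = G.map p ≫ G.map i := by rw [← G.map_comp, e]; rfl
    refine ⟨by rw [e', Functor.comp_map, reassoc_of% z, zero_comp], ⟨?_⟩⟩
    have := mono_of_isInflation (hG.map_isInflation (hF.map_inflation h))
    change Mono ((F ⋙ G).map f) at this
    exact KernelFork.IsLimit.ofι' _ _ fun {A} k hk => KernelFork.IsLimit.lift' hl k (by
      rw [← cancel_mono (G.map i), Category.assoc, ← e', hk, zero_comp])

end

/-! ### Admissibly presented functors -/

section

variable (E : Type u) [Category.{v} E] [Preadditive E] [ConflationCategory E]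

/-- The functors `F : Eᵒᵖ ⥤ Ab` with a projective presentation
`Hom(-, X) ⟶ Hom(-, Y) ⟶ F ⟶ 0` induced by an admissible morphism `f : X ⟶ Y`.
(Such functors are automatically additive.) -/
def isAdmPresented : ObjectProperty (Eᵒᵖ ⥤ AddCommGrpCat.{v}) := fun F =>
  ∃ (X Y : E) (f : X ⟶ Y), IsAdmissible f ∧
    ∃ (p : preadditiveYoneda.obj Y ⟶ F) (h : preadditiveYoneda.map f ≫ p = 0),
      (ShortComplex.mk (preadditiveYoneda.map f) p h).Exact ∧ Epi p

instance : LocallySmall.{v} (isAdmPresented E).FullSubcategory where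
  hom_small F G := by
    obtain ⟨F, X, Y, f, -, p, -, -, hp⟩ := F
    refine small_of_injective (β := G.obj.obj (Opposite.op Y))
      (f := fun a => (p ≫ a.hom).app (Opposite.op Y) (𝟙 Y)) fun a b h => ?_
    ext : 1
    rw [← cancel_epi p]
    ext Z (g : Z.unop ⟶ Y)
    have ha := congr($((p ≫ a.hom).naturality g.op) (𝟙 Y))
    have hb := congr($((p ≫ b.hom).naturality g.op) (𝟙 Y))
    have h' : (p ≫ a.hom).app (Opposite.op Y) (𝟙 Y) = (p ≫ b.hom).app (Opposite.op Y) (𝟙 Y) := h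
    have hg : (preadditiveYoneda.obj Y).map g.op (𝟙 Y) = g := Category.comp_id g
    have ha' := (congrArg ((p ≫ a.hom).app Z) hg).symm.trans ha
    have hb' := (congrArg ((p ≫ b.hom).app Z) hg).symm.trans hb
    exact ha'.trans ((congrArg (G.obj.map g.op) h').trans hb'.symm)

/-- The category of admissibly presented functors: the full subcategory of functors
`Eᵒᵖ ⥤ Ab` on the admissibly presented ones. Its sets of morphisms are small, and `ShrinkHoms`
only replaces them by isomorphic sets in the universe of the sets of morphisms of `E`. -/
def SmodAdm : Type (max u (v + 1)) :=
  ShrinkHoms.{max u (v + 1)} (isAdmPresented E).FullSubcategory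

noncomputable instance : Category.{v} (SmodAdm E) :=
  inferInstanceAs (Category.{v} (ShrinkHoms.{max u (v + 1)} (isAdmPresented E).FullSubcategory))

noncomputable instance : Preadditive (SmodAdm E) :=
  inferInstanceAs (Preadditive (ShrinkHoms.{max u (v + 1)} (isAdmPresented E).FullSubcategory))

/-- `SmodAdm E` is equivalent to the full subcategory of admissibly presented functors. -/
noncomputable def SmodAdm.equivalence : (isAdmPresented E).FullSubcategory ≌ SmodAdm E :=
  ShrinkHoms.equivalence _

instance : (SmodAdm.equivalence E).inverse.Additive :=
  inferInstanceAs (ShrinkHoms.inverse (isAdmPresented E).FullSubcategory).Additive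

/-- The inclusion of `SmodAdm E` into the category of functors `Eᵒᵖ ⥤ Ab`. -/
noncomputable def SmodAdm.incl : SmodAdm E ⥤ (Eᵒᵖ ⥤ AddCommGrpCat.{v}) :=
  (SmodAdm.equivalence E).inverse ⋙ (isAdmPresented E).ι

instance : (SmodAdm.incl E).Full := by
  unfold SmodAdm.incl
  infer_instance

instance : (SmodAdm.incl E).Faithful := by
  unfold SmodAdm.incl
  infer_instance

instance : (SmodAdm.incl E).Additive := by
  unfold SmodAdm.incl
  infer_instance

/-- The conflations of `SmodAdm E` are the sequences that are short exact as sequences of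
functors `Eᵒᵖ ⥤ Ab`. -/
noncomputable instance : ConflationCategory (SmodAdm E) where
  conf f g := ∃ h : (SmodAdm.incl E).map f ≫ (SmodAdm.incl E).map g = 0,
    (ShortComplex.mk _ _ h).ShortExact
  zero := by
    rintro X Y Z f g ⟨h, -⟩
    exact (SmodAdm.incl E).map_injective (by simpa using h)
  kernel := by
    rintro X Y Z f g ⟨h, h'⟩
    have := h'.mono_f
    have : Mono f := (SmodAdm.incl E).mono_of_mono_map this
    refine ⟨KernelFork.IsLimit.ofι' _ _ fun {A} k hk => ?_⟩
    have := KernelFork.IsLimit.lift' h'.fIsKernel ((SmodAdm.incl E).map k)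
      (by dsimp only; rw [← Functor.map_comp, hk, Functor.map_zero])
    refine ⟨(SmodAdm.incl E).preimage this.1, (SmodAdm.incl E).map_injective ?_⟩
    simpa using this.2
  cokernel := by
    rintro X Y Z f g ⟨h, h'⟩
    have := h'.epi_g
    have : Epi g := (SmodAdm.incl E).epi_of_epi_map this
    refine ⟨CokernelCofork.IsColimit.ofπ' _ _ fun {A} k hk => ?_⟩
    have := CokernelCofork.IsColimit.desc' h'.gIsCokernel ((SmodAdm.incl E).map k)
      (by dsimp only; rw [← Functor.map_comp, hk, Functor.map_zero])
    refine ⟨(SmodAdm.incl E).preimage this.1, (SmodAdm.incl E).map_injective ?_⟩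
    simpa using this.2
  of_iso := by
    rintro X Y Z X' Y' Z' f g f' g' a b c e₁ e₂ ⟨h, h'⟩
    have w : (SmodAdm.incl E).map f' ≫ (SmodAdm.incl E).map g' = 0 := by
      rw [← Functor.map_comp]
      have : f' ≫ g' = a.inv ≫ (f ≫ g) ≫ c.hom := by
        rw [Category.assoc, e₂, reassoc_of% e₁, a.inv_hom_id_assoc]
      rw [this]
      simp only [Functor.map_comp, h, zero_comp, comp_zero]
    exact ⟨w, ShortComplex.shortExact_of_iso (ShortComplex.isoMk ((SmodAdm.incl E).mapIso a)
      ((SmodAdm.incl E).mapIso b) ((SmodAdm.incl E).mapIso c)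
      (by simpa using congr((SmodAdm.incl E).map $(e₁.symm)))
      (by simpa using congr((SmodAdm.incl E).map $(e₂.symm)))) h'⟩

variable {E} in
lemma isAdmPresented_yoneda [IsExactCategory E] (Y : E) :
    isAdmPresented E (preadditiveYoneda.obj Y) := by
  have : HasZeroObject E := hasZeroObject_of_hasFiniteBiproducts E
  obtain ⟨Z, hZ⟩ := this
  have h0 : preadditiveYoneda.map (0 : Z ⟶ Y) = 0 := by
    ext X f
    exact comp_zero
  refine ⟨Z, Y, 0, ⟨Z, 𝟙 Z, 0, isDeflation_id Z, IsExactCategory.inflation_from_zero _ hZ,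
    by simp⟩, 𝟙 _, by rw [h0, zero_comp], ?_, inferInstance⟩
  rw [ShortComplex.exact_iff_mono _ h0]
  dsimp only
  infer_instance

/-- The Yoneda embedding `E ⥤ SmodAdm E`, sending `Y` to `Hom(-, Y)`. -/
noncomputable def yonedaAdm [IsExactCategory E] : E ⥤ SmodAdm E :=
  (isAdmPresented E).lift preadditiveYoneda isAdmPresented_yoneda ⋙
    (SmodAdm.equivalence E).functor

lemma essentiallySmall_smodAdm [EssentiallySmall.{v} E] : EssentiallySmall.{v} (SmodAdm E) := by
  let e := equivSmallModel.{v} E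
  refine (essentiallySmall_iff _).2 ⟨?_, inferInstance⟩
  have key : ∀ F : SmodAdm E, ∃ (X Y : E) (f : X ⟶ Y)
      (p : preadditiveYoneda.obj Y ⟶ (SmodAdm.incl E).obj F)
      (h : preadditiveYoneda.map f ≫ p = 0), Nonempty (IsColimit (CokernelCofork.ofπ p h)) := by
    intro F
    obtain ⟨X, Y, f, -, p, h, hE, hp⟩ := ((SmodAdm.equivalence E).inverse.obj F).property
    exact ⟨X, Y, f, p, h, ⟨hE.gIsCokernel⟩⟩
  choose X Y f p h hc using key
  refine small_of_injective (β := Arrow (SmallModel.{v} E))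
    (f := fun F => e.functor.mapArrow.obj (Arrow.mk (f (Quotient.out F)))) fun F G hFG => ?_
  let i := preadditiveYoneda.mapArrow.mapIso (e.functor.mapArrow.preimageIso (eqToIso hFG))
  let j := CokernelCofork.mapIsoOfIsColimit (hc _).some (hc _).some i
  have := Quotient.sound (s := isIsomorphicSetoid _)
    (⟨(SmodAdm.incl E).preimageIso j⟩ : IsIsomorphic (Quotient.out F) (Quotient.out G))
  exact (Quotient.out_eq F).symm.trans (this.trans (Quotient.out_eq G))

end

/-! ### The 2-categories of exact categories -/

/-- Essentially small exact categories: possibly large collections of objects, small sets of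
morphisms, and equivalent to a small category. -/
structure ExactCat : Type (w + 2) where
  carrier : Type (w + 1)
  [category : Category.{w} carrier]
  [preadditive : Preadditive carrier]
  [conflationCategory : ConflationCategory carrier]
  [isExactCategory : IsExactCategory carrier]
  [essentiallySmall : EssentiallySmall.{w} carrier]

attribute [instance] ExactCat.category ExactCat.preadditive ExactCat.conflationCategory
  ExactCat.isExactCategory ExactCat.essentiallySmall

/-- A class of functors between exact categories, containing identities and closed under
composition. -/
structure FunctorClass where
  prop (C D : ExactCat.{w}) : ObjectProperty (C.carrier ⥤ D.carrier)
  id_mem (C : ExactCat.{w}) : prop C C (𝟭 C.carrier)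
  comp_mem {C D E : ExactCat.{w}} {F : C.carrier ⥤ D.carrier} {G : D.carrier ⥤ E.carrier} :
    prop C D F → prop D E G → prop C E (F ⋙ G)

/-- The 2-category with objects exact categories, with 1-morphisms the functors in the class `W`,
and with 2-morphisms all natural transformations. -/
structure ExactBicat (W : FunctorClass.{w}) : Type (w + 2) where
  cat : ExactCat.{w}

namespace ExactBicat

variable {W : FunctorClass.{w}}

instance : CategoryStruct (ExactBicat W) where
  Hom C D := (W.prop C.cat D.cat).FullSubcategory
  id C := ⟨𝟭 _, W.id_mem C.cat⟩
  comp F G := ⟨F.obj ⋙ G.obj, W.comp_mem F.property G.property⟩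

instance (C D : ExactBicat W) : Category (C ⟶ D) :=
  inferInstanceAs (Category (W.prop C.cat D.cat).FullSubcategory)

/-- The 1-morphism given by a functor in the class `W`. -/
abbrev ofFunctor {C D : ExactBicat W} (F : C.cat.carrier ⥤ D.cat.carrier)
    (hF : W.prop C.cat D.cat F) : C ⟶ D :=
  ObjectProperty.FullSubcategory.mk F hF

/-- The functor underlying a 1-morphism. -/
abbrev functor {C D : ExactBicat W} (F : C ⟶ D) : C.cat.carrier ⥤ D.cat.carrier :=
  ObjectProperty.FullSubcategory.obj F

/-- The natural transformation underlying a 2-morphism. -/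
abbrev natTrans {C D : ExactBicat W} {F G : C ⟶ D} (η : F ⟶ G) : functor F ⟶ functor G :=
  InducedCategory.Hom.hom η

/-- The 2-morphism given by a natural transformation. -/
abbrev homMk {C D : ExactBicat W} {F G : C ⟶ D} (η : functor F ⟶ functor G) : F ⟶ G :=
  ObjectProperty.homMk (P := W.prop C.cat D.cat) η

/-- The invertible 2-morphism given by a natural isomorphism. -/
abbrev isoMk {C D : ExactBicat W} {F G : C ⟶ D} (η : functor F ≅ functor G) : F ≅ G where
  hom := homMk η.hom
  inv := homMk η.inv
  hom_inv_id := ObjectProperty.hom_ext _ η.hom_inv_id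
  inv_hom_id := ObjectProperty.hom_ext _ η.inv_hom_id

lemma hom₂_ext {C D : ExactBicat W} {F G : C ⟶ D} {η θ : F ⟶ G}
    (h : ∀ X, (natTrans η).app X = (natTrans θ).app X) : η = θ :=
  ObjectProperty.hom_ext _ (NatTrans.ext (funext h))

instance : Bicategory (ExactBicat W) where
  homCategory C D := inferInstance
  whiskerLeft {A B C} F {G H} η :=
    homMk (F := F ≫ G) (G := F ≫ H) (Functor.whiskerLeft (functor F) (natTrans η))
  whiskerRight {A B C} {F G} η H :=
    homMk (F := F ≫ H) (G := G ≫ H) (Functor.whiskerRight (natTrans η) (functor H))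
  associator {A B C D} F G H :=
    isoMk (F := (F ≫ G) ≫ H) (G := F ≫ G ≫ H)
      (Functor.associator (functor F) (functor G) (functor H))
  leftUnitor {A B} F := isoMk (F := 𝟙 _ ≫ F) (G := F) (functor F).leftUnitor
  rightUnitor {A B} F := isoMk (F := F ≫ 𝟙 _) (G := F) (functor F).rightUnitor
  whiskerLeft_id _ _ := hom₂_ext fun _ => rfl
  whiskerLeft_comp _ _ _ _ _ _ := hom₂_ext fun _ => rfl
  id_whiskerLeft _ := hom₂_ext fun _ =>
    ((Category.id_comp _).trans (Category.comp_id _)).symm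
  comp_whiskerLeft _ _ _ _ _ := hom₂_ext fun _ =>
    ((Category.id_comp _).trans (Category.comp_id _)).symm
  id_whiskerRight F G := hom₂_ext fun _ => (functor G).map_id _
  comp_whiskerRight _ _ H := hom₂_ext fun _ => (functor H).map_comp _ _
  whiskerRight_id _ := hom₂_ext fun _ =>
    ((Category.id_comp _).trans (Category.comp_id _)).symm
  whiskerRight_comp _ _ _ := hom₂_ext fun _ =>
    ((Category.id_comp _).trans (Category.comp_id _)).symm
  whisker_assoc _ _ _ _ _ := hom₂_ext fun _ =>
    ((Category.id_comp _).trans (Category.comp_id _)).symm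
  whisker_exchange η θ := hom₂_ext fun _ => ((natTrans θ).naturality _).symm
  pentagon {_ _ _ _ _} F G H K := by
    refine hom₂_ext fun X => ?_
    change ((functor K).map (𝟙 _) ≫ 𝟙 _ ≫ 𝟙 _) = 𝟙 _ ≫ 𝟙 _
    simp only [Category.comp_id]
    exact (functor K).map_id _
  triangle {_ _ _} F G := by
    refine hom₂_ext fun X => ?_
    change 𝟙 _ ≫ 𝟙 _ = (functor G).map (𝟙 _)
    simp only [Category.comp_id]
    exact ((functor G).map_id _).symm

/-- The inclusion pseudofunctor for a class of functors contained in another one: the identity on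
objects, on functors and on natural transformations. -/
def inclusion {W W' : FunctorClass.{w}} (h : ∀ C D, W.prop C D ≤ W'.prop C D) :
    Pseudofunctor (ExactBicat W) (ExactBicat W') where
  obj C := ⟨C.cat⟩
  map {C D} F := ofFunctor (functor (C := C) (D := D) F)
    (h _ _ _ (ObjectProperty.FullSubcategory.property F))
  map₂ {_ _ F G} η := homMk (natTrans (F := F) (G := G) η)
  map₂_id _ := rfl
  map₂_comp _ _ := rfl
  mapId _ := Iso.refl _
  mapComp _ _ := Iso.refl _
  map₂_whisker_left _ _ _ _ := hom₂_ext fun _ =>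
    ((Category.id_comp _).trans (Category.comp_id _)).symm
  map₂_whisker_right _ _ := hom₂_ext fun _ =>
    ((Category.id_comp _).trans (Category.comp_id _)).symm
  map₂_associator {_ _ _ _} F G H := by
    refine hom₂_ext fun X => ?_
    change 𝟙 _ = 𝟙 _ ≫ (functor H).map (𝟙 _) ≫ 𝟙 _ ≫ 𝟙 _ ≫ 𝟙 _
    simp only [Category.comp_id]
    exact ((Category.id_comp _).trans ((functor H).map_id _)).symm
  map₂_left_unitor {_ _} F := by
    refine hom₂_ext fun X => ?_
    change 𝟙 _ = 𝟙 _ ≫ (functor F).map (𝟙 _) ≫ 𝟙 _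
    simp only [Category.comp_id]
    exact ((Category.id_comp _).trans ((functor F).map_id _)).symm
  map₂_right_unitor {_ _} F := by
    refine hom₂_ext fun X => ?_
    change 𝟙 _ = 𝟙 _ ≫ 𝟙 _ ≫ 𝟙 _
    simp only [Category.comp_id]

end ExactBicat

/-- The class of exact functors. -/
def exactClass : FunctorClass.{w} where
  prop _ _ := IsExactFunctor
  id_mem _ := .id
  comp_mem := .comp

/-- The class of left exact functors. -/
def leftExactClass : FunctorClass.{w} where
  prop _ _ := IsLeftExactFunctor
  id_mem _ := IsExactFunctor.id.isLeftExactFunctor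
  comp_mem := .comp

/-- The 2-category of exact categories, exact functors and natural transformations. -/
abbrev Ex := ExactBicat exactClass.{w}

/-- The 2-category of exact categories, left exact functors and natural transformations. -/
abbrev ExL := ExactBicat leftExactClass.{w}

/-- The inclusion of `Ex` into `ExL`. -/
def exInclusion : Pseudofunctor Ex.{w} ExL.{w} :=
  ExactBicat.inclusion fun _ _ _ h => h.isLeftExactFunctor

/-- `SmodAdm E` as an object of the 2-category `Ex`. -/
noncomputable def smodAdmObj (E : ExL.{w}) (h : IsExactCategory (SmodAdm E.cat.carrier)) : Ex.{w} where
  cat :=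
    { carrier := SmodAdm E.cat.carrier
      essentiallySmall := essentiallySmall_smodAdm _ }

/-- The Yoneda embedding as a 1-morphism of `ExL`. -/
noncomputable def yonedaHom (E : ExL.{w}) (h : IsExactCategory (SmodAdm E.cat.carrier))
    (hY : IsLeftExactFunctor (yonedaAdm E.cat.carrier)) : E ⟶ exInclusion.obj (smodAdmObj E h) :=
  ExactBicat.ofFunctor (D := exInclusion.obj (smodAdmObj E h)) (yonedaAdm E.cat.carrier) hY

/-- For exact categories `X` and `E'`, and a 1-morphism `η : E ⟶ X` of `ExL`, the functor
`Hom_Ex(X, E') ⥤ Hom_ExL(E, E')` of restriction along `η`. -/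
def restriction {E : ExL.{w}} {X : Ex.{w}} (η : E ⟶ exInclusion.obj X) (E' : Ex.{w}) :
    (X ⟶ E') ⥤ (E ⟶ exInclusion.obj E') :=
  exInclusion.mapFunctor X E' ⋙ Bicategory.precomp _ η

end AdmPres

/-! An admissibly presented functor `F` is the cokernel of `Hom(-, f)` for an admissible `f : X ⟶
Y`. Everything about such functors is tested on morphisms out of representables, hence reduces to
computations in `E`. `IsPresentation` and `IsLocallyShortExact` express cokernels and short exact
sequences in this form.

Exact structure. A full subcategory of an abelian category that is closed under extensions and
contains zero is exact (`isExactCategory_of_extensionClosed`), so the point is that extensions of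
admissibly presented functors are admissibly presented. The horseshoe lemma gives a triangular
presentation `f` of the middle term out of presentations `f'` and `f''`. Its off-diagonal entry,
restricted to the kernel of `f''`, factors through `f'`. This makes `f` admissible
(`exists_conf_of_triangular`): its image is the extension of the image of `f''` by that of `f'`
obtained as a pushout.

Extension of a left exact `Φ`. It maps admissible morphisms to admissible ones, so `F` can be sent
to the cokernel of `Φ.map f`; lifting morphisms to presentations makes this a functor. For exactness
the triangular lemma is applied once more, in the target, to the image under `Φ` of a horseshoe
presentation: left exactness keeps the kernel of `f''`, so the factorisation of the off-diagonal
entry survives. The lemma also says that the cokernels form a conflation.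

Uniqueness. A presentation breaks up into two conflations of admissibly presented functors
(`IsPresentation.exists_conf`), so an exact functor preserves it as a cokernel. Hence natural
transformations out of an exact functor are the same as their restrictions to representables. This
gives uniqueness, fullness and faithfulness of restriction, and all the pseudofunctor laws. -/

namespace AdmPres

/-! ### Joint cancellation for biproducts. -/

section Bicone

variable {C : Type u} [Category.{v} C] [Preadditive C]

lemma binaryBicone_hom_ext_from {X Y T : C} {D : BinaryBicone X Y}
    (hD : D.fst ≫ D.inl + D.snd ≫ D.inr = 𝟙 D.pt) {f g : D.pt ⟶ T}
    (h₁ : D.inl ≫ f = D.inl ≫ g) (h₂ : D.inr ≫ f = D.inr ≫ g) : f = g := by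
  rw [← Category.id_comp f, ← Category.id_comp g, ← hD]
  simp [h₁, h₂]

lemma binaryBicone_hom_ext_to {X Y T : C} {D : BinaryBicone X Y}
    (hD : D.fst ≫ D.inl + D.snd ≫ D.inr = 𝟙 D.pt) {f g : T ⟶ D.pt}
    (h₁ : f ≫ D.fst = g ≫ D.fst) (h₂ : f ≫ D.snd = g ≫ D.snd) : f = g := by
  rw [← Category.comp_id f, ← Category.comp_id g, ← hD]
  simp [reassoc_of% h₁, reassoc_of% h₂]

end Bicone

/-! ### Diagram lemmas in an exact category, up to the horseshoe lemma for admissible morphisms. -/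

section ExactCategory

variable {C : Type u} [Category.{v} C] [Preadditive C] [ConflationCategory C]

lemma epi_of_isDeflation {X Y : C} {f : X ⟶ Y} (hf : IsDeflation f) : Epi f := by
  obtain ⟨Z, g, h⟩ := hf
  exact Cofork.IsColimit.epi (ConflationCategory.cokernel h).some

lemma conf_lift {X Y Z T : C} {f : X ⟶ Y} {g : Y ⟶ Z} (h : ConflationCategory.conf f g)
    (k : T ⟶ Y) (hk : k ≫ g = 0) : ∃ l : T ⟶ X, l ≫ f = k :=
  let r := KernelFork.IsLimit.lift' (ConflationCategory.kernel h).some k hk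
  ⟨r.1, r.2⟩

lemma conf_desc {X Y Z T : C} {f : X ⟶ Y} {g : Y ⟶ Z} (h : ConflationCategory.conf f g)
    (k : Y ⟶ T) (hk : f ≫ k = 0) : ∃ l : Z ⟶ T, g ≫ l = k :=
  let r := CokernelCofork.IsColimit.desc' (ConflationCategory.cokernel h).some k hk
  ⟨r.1, r.2⟩

lemma mono_of_conf {X Y Z : C} {f : X ⟶ Y} {g : Y ⟶ Z} (h : ConflationCategory.conf f g) :
    Mono f := mono_of_isInflation ⟨_, _, h⟩

lemma epi_of_conf {X Y Z : C} {f : X ⟶ Y} {g : Y ⟶ Z} (h : ConflationCategory.conf f g) :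
    Epi g := epi_of_isDeflation ⟨_, _, h⟩

lemma conf_of_isCokernel {X Y Z : C} {f : X ⟶ Y} {g : Y ⟶ Z} (w : f ≫ g = 0)
    (hg : IsColimit (CokernelCofork.ofπ g w)) (hf : IsInflation f) :
    ConflationCategory.conf f g := by
  obtain ⟨K, k, hk⟩ := hf
  have hl := (ConflationCategory.cokernel hk).some
  refine ConflationCategory.of_iso (Iso.refl X) (Iso.refl Y)
    (hl.coconePointUniqueUpToIso hg) (by simp) ?_ hk
  have := hl.comp_coconePointUniqueUpToIso_hom hg WalkingParallelPair.one
  simpa using this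

/-- The map to the cokernel is determined by a weak universal property and being epi. -/
lemma conf_of_desc {X Y Z : C} {f : X ⟶ Y} {g : Y ⟶ Z} (hf : IsInflation f) (w : f ≫ g = 0)
    [Epi g] (hg : ∀ {T : C} (k : Y ⟶ T), f ≫ k = 0 → ∃ l : Z ⟶ T, g ≫ l = k) :
    ConflationCategory.conf f g :=
  conf_of_isCokernel w (CokernelCofork.IsColimit.ofπ' _ _ fun k hk =>
    ⟨(hg k hk).choose, (hg k hk).choose_spec⟩) hf

/-- The left leg of a cocone prescribes its value on the summand `Y`. The right leg minus the
contribution of that value kills `a`, so it descends along `b` and gives the component on `K`. -/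
lemma isPushout_of_conf_of_comp {I J K Y : C} {a : I ⟶ J} {b : J ⟶ K}
    (h : ConflationCategory.conf a b) {D : BinaryBicone Y K}
    (hD : D.fst ≫ D.inl + D.snd ≫ D.inr = 𝟙 D.pt) (v : J ⟶ D.pt) (hv : v ≫ D.snd = b)
    {i : I ⟶ Y} (hi : a ≫ v = i ≫ D.inl) : IsPushout i a D.inl v := by
  have hi' : a ≫ v ≫ D.fst = i := by rw [reassoc_of% hi]; simp
  have := epi_of_conf h
  have key (s : PushoutCocone i a) : ∃ r, b ≫ r = s.inr - v ≫ D.fst ≫ s.inl :=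
    conf_desc h _ (by simp [← s.condition, ← hi'])
  choose r hr using key
  refine ⟨⟨hi.symm⟩, ⟨PushoutCocone.IsColimit.mk _ (fun s => D.fst ≫ s.inl + D.snd ≫ r s)
    (fun s => by simp) (fun s => by simp [reassoc_of% hv, hr]) fun s m h₁ h₂ => ?_⟩⟩
  refine binaryBicone_hom_ext_from hD (by simp [h₁]) ?_
  have e := v ≫= (hD =≫ m)
  simp only [Preadditive.add_comp, Category.assoc, Preadditive.comp_add, Category.id_comp,
    reassoc_of% hv, h₁, h₂] at e
  rw [← cancel_epi b]
  simp [hr, ← e]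

/-- Dual argument: the component on `X` is prescribed, and the remaining difference is killed by
`b`, hence lifts along `a`. -/
lemma isPullback_of_conf_of_comp {I J K X : C} {a : I ⟶ J} {b : J ⟶ K}
    (h : ConflationCategory.conf a b) {D : BinaryBicone I X}
    (hD : D.fst ≫ D.inl + D.snd ≫ D.inr = 𝟙 D.pt) (v : D.pt ⟶ J) (hv : D.inl ≫ v = a)
    {q : X ⟶ K} (hq : v ≫ b = D.snd ≫ q) : IsPullback v D.snd b q := by
  have hq' : D.inr ≫ v ≫ b = q := by rw [hq]; simp
  have := mono_of_conf h
  have key (s : PullbackCone b q) : ∃ r, r ≫ a = s.fst - s.snd ≫ D.inr ≫ v :=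
    conf_lift h _ (by simp [s.condition, hq'])
  choose r hr using key
  refine ⟨⟨hq⟩, ⟨PullbackCone.IsLimit.mk _ (fun s => r s ≫ D.inl + s.snd ≫ D.inr)
    (fun s => by simp [hv, hr]) (fun s => by simp) fun s m h₁ h₂ => ?_⟩⟩
  refine binaryBicone_hom_ext_to hD ?_ (by simp [h₂])
  have e := m ≫= (hD =≫ v)
  simp only [Preadditive.add_comp, Category.assoc, Preadditive.comp_add, Category.id_comp,
    hv, h₁, reassoc_of% h₂] at e
  rw [← cancel_mono a]
  simp [hr, ← e]

variable [IsExactCategory C]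

/-- The pushout of a conflation. -/
lemma conf_of_isPushout {X Y Z P Q : C} {f : Z ⟶ X} {g : Z ⟶ Y} {p : X ⟶ P} {q : Y ⟶ P}
    (sq : IsPushout f g p q) {c : Y ⟶ Q} (hc : ConflationCategory.conf g c) {c' : P ⟶ Q}
    (h₁ : p ≫ c' = 0) (h₂ : q ≫ c' = c) : ConflationCategory.conf p c' := by
  have := epi_of_conf hc
  have : Epi c' := epi_of_epi_fac h₂
  refine conf_of_desc (IsExactCategory.inflation_pushout sq ⟨_, _, hc⟩) h₁ fun k hk => ?_
  obtain ⟨l, hl⟩ := conf_desc hc (q ≫ k) (by rw [← sq.w_assoc, hk, comp_zero])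
  exact ⟨l, sq.hom_ext (by rw [reassoc_of% h₁, hk, zero_comp]) (by rw [reassoc_of% h₂, hl])⟩

/-- Noether's isomorphism theorem. -/
lemma conf_of_comp {A B D Q₁ Q₂ Q₃ : C} {f : A ⟶ B} {g : B ⟶ D} {c₁ : B ⟶ Q₁} {c₂ : D ⟶ Q₂}
    {c₃ : D ⟶ Q₃} (h₁ : ConflationCategory.conf f c₁) (h₂ : ConflationCategory.conf g c₂)
    (h₃ : ConflationCategory.conf (f ≫ g) c₃) {s : Q₁ ⟶ Q₃} {t : Q₃ ⟶ Q₂}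
    (hs : c₁ ≫ s = g ≫ c₃) (ht : c₃ ≫ t = c₂) : ConflationCategory.conf s t := by
  have := epi_of_conf h₁
  have := epi_of_conf h₃
  have z := ConflationCategory.zero h₁
  have key (r : PushoutCocone c₁ g) : ∃ l, c₃ ≫ l = r.inr :=
    conf_desc h₃ _ (by rw [Category.assoc, ← r.condition, reassoc_of% z, zero_comp])
  choose l hl using key
  -- Both `c₁` and `c₃` are quotients by `A`, so `s` is the pushout of `g` along `c₁`, and a pushout
  -- of a conflation is a conflation with the same cokernel.
  have sq : IsPushout c₁ g s c₃ := by
    refine ⟨⟨hs⟩, ⟨PushoutCocone.IsColimit.mk _ l (fun r => ?_) hl fun r m _ hm => ?_⟩⟩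
    · rw [← cancel_epi c₁, reassoc_of% hs, hl, r.condition]
    · rw [← cancel_epi c₃, hl, hm]
  refine conf_of_isPushout sq h₂ ?_ ht
  rw [← cancel_epi c₁, reassoc_of% hs, ht, ConflationCategory.zero h₂, comp_zero]

/-- A triangular map out of the middle term of a conflation whose outer components are inflations
is an inflation, and the cokernels form a conflation. -/
lemma conf_of_isInflation_of_isInflation {I' J I'' Y' Y'' C' C'' : C} {a : I' ⟶ J} {b : J ⟶ I''}
    (h : ConflationCategory.conf a b) {i' : I' ⟶ Y'} {c' : Y' ⟶ C'}
    (h' : ConflationCategory.conf i' c') {i'' : I'' ⟶ Y''} {c'' : Y'' ⟶ C''}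
    (h'' : ConflationCategory.conf i'' c'') {D : BinaryBicone Y' Y''}
    (hD : D.fst ≫ D.inl + D.snd ≫ D.inr = 𝟙 D.pt) (v : J ⟶ D.pt) (hv₁ : a ≫ v = i' ≫ D.inl)
    (hv₂ : v ≫ D.snd = b ≫ i'') :
    IsInflation v ∧ ∀ {Q : C} (c : D.pt ⟶ Q), ConflationCategory.conf v c →
      ∃ (s : C' ⟶ Q) (t : Q ⟶ C''), ConflationCategory.conf s t ∧ c' ≫ s = D.inl ≫ c ∧
        c ≫ t = D.snd ≫ c'' := by
  have := hasBinaryBiproducts_of_finite_biproducts C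
  let N := BinaryBiproduct.bicone Y' I''
  have hN : N.fst ≫ N.inl + N.snd ≫ N.inr = 𝟙 N.pt := by simp [N]
  -- Factor `v` through `Y' ⊕ I''`, treating one diagonal entry at a time: `v₂` is a pushout of `i'`
  -- and `r` is a pushout of `i''`. Both are inflations, with cokernels `C'` and `C''`, and
  -- Noether's theorem then assembles the cokernel of the composite.
  let v₂ : J ⟶ N.pt := v ≫ D.fst ≫ N.inl + b ≫ N.inr
  let r : N.pt ⟶ D.pt := N.fst ≫ D.inl + N.snd ≫ i'' ≫ D.inr
  have hvr : v₂ ≫ r = v := by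
    refine binaryBicone_hom_ext_to hD ?_ ?_ <;> simp [v₂, r, hv₂]
  have hab := ConflationCategory.zero h
  have sq₁ : IsPushout i' a N.inl v₂ := by
    refine isPushout_of_conf_of_comp h hN v₂ (by simp [v₂]) ?_
    simp only [v₂, Preadditive.comp_add, reassoc_of% hv₁, reassoc_of% hab]
    simp
  obtain ⟨γ, hγ₁, hγ₂⟩ : ∃ γ : N.pt ⟶ C', N.inl ≫ γ = c' ∧ v₂ ≫ γ = 0 := by
    refine ⟨sq₁.desc c' 0 (by rw [ConflationCategory.zero h', comp_zero]), by simp, by simp⟩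
  have hc₁ : ConflationCategory.conf v₂ γ := conf_of_isPushout sq₁.flip h' hγ₂ hγ₁
  have sq₂ : IsPushout N.inr i'' r D.inr := by
    refine ⟨⟨by simp [r]⟩, ⟨PushoutCocone.IsColimit.mk _
      (fun s => D.fst ≫ N.inl ≫ s.inl + D.snd ≫ s.inr)
      (fun s => ?_) (fun s => ?_) fun s m h₁ h₂ => ?_⟩⟩
    · refine binaryBicone_hom_ext_from hN ?_ ?_ <;> simp [r, s.condition]
    · simp
    · refine binaryBicone_hom_ext_from hD ?_ ?_ <;> simp [← h₁, ← h₂, r]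
  have hc₂ : ConflationCategory.conf r (D.snd ≫ c'') := by
    refine conf_of_isPushout sq₂ h'' ?_ (by simp)
    simp [r, ConflationCategory.zero h'']
  refine ⟨hvr ▸ IsExactCategory.inflation_comp _ _ ⟨_, _, hc₁⟩ ⟨_, _, hc₂⟩, fun c hc => ?_⟩
  rw [← hvr] at hc
  obtain ⟨s, hs⟩ := conf_desc hc₁ (r ≫ c) (by
    rw [← Category.assoc]; exact ConflationCategory.zero hc)
  obtain ⟨t, ht⟩ := conf_desc hc (D.snd ≫ c'') (by
    rw [Category.assoc, ConflationCategory.zero hc₂, comp_zero])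
  refine ⟨s, t, conf_of_comp hc₁ hc₂ hc hs ht, ?_, ht⟩
  rw [← hγ₁, Category.assoc, hs]
  simp [r]

/-- A triangular map into the middle term of a conflation whose outer components are deflations
is a deflation. -/
lemma isDeflation_of_isDeflation_of_isDeflation {I' J I'' X' X'' : C} {a : I' ⟶ J} {b : J ⟶ I''}
    (h : ConflationCategory.conf a b) {p' : X' ⟶ I'} (h' : IsDeflation p') {p'' : X'' ⟶ I''}
    (h'' : IsDeflation p'') {B : BinaryBicone X' X''}
    (hB : B.fst ≫ B.inl + B.snd ≫ B.inr = 𝟙 B.pt) (v : B.pt ⟶ J) (hv₁ : B.inl ≫ v = p' ≫ a)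
    (hv₂ : v ≫ b = B.snd ≫ p'') : IsDeflation v := by
  have := hasBinaryBiproducts_of_finite_biproducts C
  let N := BinaryBiproduct.bicone I' X''
  have hN : N.fst ≫ N.inl + N.snd ≫ N.inr = 𝟙 N.pt := by simp [N]
  -- Factor `v` through `I' ⊕ X''`: here `r` is a pullback of `p'` and `v₂` is a pullback of `p''`.
  let v₂ : N.pt ⟶ J := N.fst ≫ a + N.snd ≫ B.inr ≫ v
  let r : B.pt ⟶ N.pt := B.fst ≫ p' ≫ N.inl + B.snd ≫ N.inr
  have hvr : r ≫ v₂ = v := by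
    refine binaryBicone_hom_ext_from hB ?_ ?_ <;> simp [v₂, r, hv₁]
  have hab := ConflationCategory.zero h
  have sq₁ : IsPullback v₂ N.snd b p'' := by
    refine isPullback_of_conf_of_comp h hN v₂ (by simp [v₂]) ?_
    simp [v₂, hab, hv₂]
  have sq₂ : IsPullback r B.fst N.fst p' := by
    refine ⟨⟨by simp [r]⟩, ⟨PullbackCone.IsLimit.mk _
      (fun s => s.snd ≫ B.inl + s.fst ≫ N.snd ≫ B.inr)
      (fun s => ?_) (fun s => ?_) fun s m h₁ h₂ => ?_⟩⟩
    · refine binaryBicone_hom_ext_to hN ?_ ?_ <;> simp [r, s.condition]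
    · simp
    · refine binaryBicone_hom_ext_to hB ?_ ?_ <;> simp [← h₁, ← h₂, r]
  exact hvr ▸ IsExactCategory.deflation_comp _ _ (IsExactCategory.deflation_pullback sq₂ h')
    (IsExactCategory.deflation_pullback sq₁ h'')

/-- The horseshoe lemma for admissible morphisms. -/
lemma exists_conf_of_triangular {X' X'' Y' Y'' I' I'' K'' C' C'' : C} {p' : X' ⟶ I'} {i' : I' ⟶ Y'}
    {c' : Y' ⟶ C'} (hp' : IsDeflation p') (hi' : ConflationCategory.conf i' c') {k'' : K'' ⟶ X''}
    {p'' : X'' ⟶ I''} {i'' : I'' ⟶ Y''} {c'' : Y'' ⟶ C''} (hp'' : ConflationCategory.conf k'' p'')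
    (hi'' : ConflationCategory.conf i'' c'') {B : BinaryBicone X' X''}
    (hB : B.fst ≫ B.inl + B.snd ≫ B.inr = 𝟙 B.pt) {D : BinaryBicone Y' Y''}
    (hD : D.fst ≫ D.inl + D.snd ≫ D.inr = 𝟙 D.pt) {f : B.pt ⟶ D.pt}
    (hf₁ : B.inl ≫ f = p' ≫ i' ≫ D.inl) (hf₂ : f ≫ D.snd = B.snd ≫ p'' ≫ i'')
    (m : K'' ⟶ X') (hm : k'' ≫ B.inr ≫ f ≫ D.fst = m ≫ p' ≫ i') :
    ∃ (J : C) (π : B.pt ⟶ J) (v : J ⟶ D.pt), IsDeflation π ∧ IsInflation v ∧ π ≫ v = f ∧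
      ∀ {Q : C} (c : D.pt ⟶ Q), ConflationCategory.conf v c →
        ∃ (s : C' ⟶ Q) (t : Q ⟶ C''), ConflationCategory.conf s t ∧ c' ≫ s = D.inl ≫ c ∧
          c ≫ t = D.snd ≫ c'' := by
  -- The image of `f` has to be an extension of `I''` by `I'`. By `hm`, `f` carries `K''` into `I'`
  -- via `m ≫ p'`, so this extension is obtained from `K'' ⟶ X'' ⟶ I''` by pushing out along `m ≫
  -- p'`.
  obtain ⟨J, a, q, sq⟩ : ∃ (J : C) (a : I' ⟶ J) (q : X'' ⟶ J), IsPushout (m ≫ p') k'' a q :=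
    have := IsExactCategory.hasPushout (m ≫ p') k'' ⟨_, _, hp''⟩
    ⟨_, _, _, IsPushout.of_hasPushout (m ≫ p') k''⟩
  have z := ConflationCategory.zero hp''
  have hm' : k'' ≫ B.inr ≫ f = m ≫ p' ≫ i' ≫ D.inl := by
    refine binaryBicone_hom_ext_to hD (by simp [hm]) ?_
    simp [hf₂, reassoc_of% z]
  obtain ⟨b, hb₁, hb₂⟩ : ∃ b : J ⟶ I'', a ≫ b = 0 ∧ q ≫ b = p'' :=
    ⟨sq.desc 0 p'' (by rw [z, comp_zero]), by simp, by simp⟩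
  have hab := conf_of_isPushout sq hp'' hb₁ hb₂
  obtain ⟨v, hv₁, hv₂⟩ : ∃ v : J ⟶ D.pt, a ≫ v = i' ≫ D.inl ∧ q ≫ v = B.inr ≫ f :=
    ⟨sq.desc (i' ≫ D.inl) (B.inr ≫ f) (by simp [hm']), by simp, by simp⟩
  obtain ⟨hv, H⟩ := conf_of_isInflation_of_isInflation hab hi' hi'' hD v hv₁ (by
    refine sq.hom_ext ?_ ?_
    · simp [reassoc_of% hv₁, reassoc_of% hb₁]
    · simp [reassoc_of% hv₂, reassoc_of% hb₂, hf₂])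
  refine ⟨J, B.fst ≫ p' ≫ a + B.snd ≫ q, v,
    isDeflation_of_isDeflation_of_isDeflation hab hp' ⟨_, _, hp''⟩ hB _ (by simp)
      (by simp [hb₁, hb₂]), hv, ?_, H⟩
  refine binaryBicone_hom_ext_from hB ?_ ?_ <;> simp [hv₁, hv₂, hf₁]

end ExactCategory

/-! ### Short exact sequences in an abelian category. -/

section ShortExact

variable {B : Type u} [Category.{v} B] [Abelian B]

/-- `f` and `g` form a short exact sequence. -/
def IsShortExact {X Y Z : B} (f : X ⟶ Y) (g : Y ⟶ Z) : Prop :=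
  ∃ h : f ≫ g = 0, (ShortComplex.mk f g h).ShortExact

namespace IsShortExact

lemma of_lift {X Y Z : B} {f : X ⟶ Y} {g : Y ⟶ Z} (w : f ≫ g = 0) [Mono f] [Epi g]
    (hf : ∀ {T : B} (k : T ⟶ Y), k ≫ g = 0 → ∃ l : T ⟶ X, l ≫ f = k) : IsShortExact f g :=
  ⟨w, { exact := ShortComplex.exact_of_f_is_kernel _ (KernelFork.IsLimit.ofι' _ _ fun k hk =>
          ⟨(hf k hk).choose, (hf k hk).choose_spec⟩)
        mono_f := ‹_›
        epi_g := ‹_› }⟩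

lemma of_desc {X Y Z : B} {f : X ⟶ Y} {g : Y ⟶ Z} (w : f ≫ g = 0) [Mono f] [Epi g]
    (hg : ∀ {T : B} (k : Y ⟶ T), f ≫ k = 0 → ∃ l : Z ⟶ T, g ≫ l = k) : IsShortExact f g :=
  ⟨w, { exact := ShortComplex.exact_of_g_is_cokernel _ (CokernelCofork.IsColimit.ofπ' _ _
          fun k hk => ⟨(hg k hk).choose, (hg k hk).choose_spec⟩)
        mono_f := ‹_›
        epi_g := ‹_› }⟩

variable {X Y Z : B} {f : X ⟶ Y} {g : Y ⟶ Z}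

lemma mono (h : IsShortExact f g) : Mono f := h.2.mono_f

lemma epi (h : IsShortExact f g) : Epi g := h.2.epi_g

lemma exists_lift (h : IsShortExact f g) {T : B} (k : T ⟶ Y) (hk : k ≫ g = 0) :
    ∃ l : T ⟶ X, l ≫ f = k :=
  let r := KernelFork.IsLimit.lift' h.2.fIsKernel k hk
  ⟨r.1, r.2⟩

lemma exists_desc (h : IsShortExact f g) {T : B} (k : Y ⟶ T) (hk : f ≫ k = 0) :
    ∃ l : Z ⟶ T, g ≫ l = k :=
  let r := CokernelCofork.IsColimit.desc' h.2.gIsCokernel k hk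
  ⟨r.1, r.2⟩

lemma of_iso (h : IsShortExact f g) {X' Y' Z' : B} {f' : X' ⟶ Y'} {g' : Y' ⟶ Z'}
    (a : X ≅ X') (b : Y ≅ Y') (c : Z ≅ Z') (e₁ : f ≫ b.hom = a.hom ≫ f')
    (e₂ : g ≫ c.hom = b.hom ≫ g') : IsShortExact f' g' := by
  have w : f' ≫ g' = 0 := by
    have : f' ≫ g' = a.inv ≫ (f ≫ g) ≫ c.hom := by
      rw [Category.assoc, e₂, reassoc_of% e₁, a.inv_hom_id_assoc]
    rw [this, h.1, zero_comp, comp_zero]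
  exact ⟨w, ShortComplex.shortExact_of_iso (ShortComplex.isoMk a b c e₁.symm e₂.symm) h.2⟩

lemma pullback {P W : B} {p : P ⟶ W} {q : P ⟶ Y} {h : W ⟶ Z} (sq : IsPullback p q h g)
    (hfg : IsShortExact f g) {k : X ⟶ P} (h₁ : k ≫ p = 0) (h₂ : k ≫ q = f) :
    IsShortExact k p := by
  have := hfg.mono
  have := hfg.epi
  have : Mono k := mono_of_mono_fac h₂
  have : Epi p := Abelian.epi_fst_of_isLimit _ _ sq.isLimit
  refine of_lift h₁ fun t ht => ?_
  obtain ⟨l, hl⟩ := hfg.exists_lift (t ≫ q) (by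
    rw [Category.assoc, ← sq.w, reassoc_of% ht, zero_comp])
  exact ⟨l, sq.hom_ext (by rw [Category.assoc, h₁, ht, comp_zero])
    (by rw [Category.assoc, h₂, hl])⟩

lemma pushout {P W : B} {p : W ⟶ P} {q : Y ⟶ P} {h : X ⟶ W} (sq : IsPushout h f p q)
    (hfg : IsShortExact f g) {c : P ⟶ Z} (h₁ : p ≫ c = 0) (h₂ : q ≫ c = g) :
    IsShortExact p c := by
  have := hfg.mono
  have := hfg.epi
  have : Epi c := epi_of_epi_fac h₂
  have : Mono p := Abelian.mono_inl_of_isColimit _ _ sq.isColimit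
  refine of_desc h₁ fun t ht => ?_
  obtain ⟨l, hl⟩ := hfg.exists_desc (q ≫ t) (by rw [← sq.w_assoc, ht, comp_zero])
  exact ⟨l, sq.hom_ext (by rw [reassoc_of% h₁, ht, zero_comp]) (by rw [reassoc_of% h₂, hl])⟩

end IsShortExact

end ShortExact

/-! ### Extension-closed subcategories are exact. -/

section ExtensionClosed

variable {A : Type u} [Category.{v} A] {B : Type u'} [Category.{v'} B] [Abelian B]
  {i : A ⥤ B} [i.Full] [i.Faithful]

/-- The ambient pullback is an extension of `X` by the kernel `K`, so it lies in the subcategory,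
and a fully faithful functor reflects pullback squares. -/
lemma exists_isPullback_of_extensionClosed
    (hext : ∀ {X Y Z : B} {f : X ⟶ Y} {g : Y ⟶ Z}, IsShortExact f g → i.essImage X →
      i.essImage Z → i.essImage Y) {K X Y Z : A} (f : X ⟶ Z) {k : K ⟶ Y} {g : Y ⟶ Z}
    (h : IsShortExact (i.map k) (i.map g)) :
    ∃ (P : A) (p : P ⟶ X) (q : P ⟶ Y) (k' : K ⟶ P), IsPullback p q f g ∧
      IsPullback (i.map p) (i.map q) (i.map f) (i.map g) ∧ IsShortExact (i.map k') (i.map p) ∧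
      k' ≫ q = k := by
  have sq := IsPullback.of_hasPullback (i.map f) (i.map g)
  obtain ⟨l, hl₁, hl₂⟩ : ∃ l : i.obj K ⟶ pullback (i.map f) (i.map g),
      l ≫ pullback.fst _ _ = 0 ∧ l ≫ pullback.snd _ _ = i.map k :=
    ⟨pullback.lift 0 (i.map k) (by rw [h.1, zero_comp]), pullback.lift_fst _ _ _,
      pullback.lift_snd _ _ _⟩
  have hs := IsShortExact.pullback sq h hl₁ hl₂
  obtain ⟨P, ⟨e⟩⟩ := hext hs (i.obj_mem_essImage K) (i.obj_mem_essImage X)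
  obtain ⟨p, hp⟩ := i.map_surjective (e.hom ≫ pullback.fst _ _)
  obtain ⟨q, hq⟩ := i.map_surjective (e.hom ≫ pullback.snd _ _)
  obtain ⟨k', hk'⟩ := i.map_surjective (l ≫ e.inv)
  have w : p ≫ f = q ≫ g := i.map_injective (by simp [hp, hq, sq.w])
  have sq' : IsPullback (i.map p) (i.map q) (i.map f) (i.map g) :=
    IsPullback.of_iso sq e.symm (Iso.refl _) (Iso.refl _) (Iso.refl _) (by simp [hp])
      (by simp [hq]) (by simp) (by simp)
  refine ⟨P, p, q, k', IsPullback.of_map i w sq', sq',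
    hs.of_iso (Iso.refl _) e.symm (Iso.refl _) ?_ ?_, ?_⟩
  · simp [hk']
  · simp [hp]
  · exact i.map_injective (by simp [hk', hq, hl₂])

lemma exists_isPushout_of_extensionClosed
    (hext : ∀ {X Y Z : B} {f : X ⟶ Y} {g : Y ⟶ Z}, IsShortExact f g → i.essImage X →
      i.essImage Z → i.essImage Y) {K X Y Z : A} (f : X ⟶ Z) {k : Y ⟶ K} {g : X ⟶ Y}
    (h : IsShortExact (i.map g) (i.map k)) :
    ∃ (P : A) (p : Z ⟶ P) (q : Y ⟶ P) (k' : P ⟶ K), IsPushout f g p q ∧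
      IsPushout (i.map f) (i.map g) (i.map p) (i.map q) ∧ IsShortExact (i.map p) (i.map k') ∧
      q ≫ k' = k := by
  have sq := IsPushout.of_hasPushout (i.map f) (i.map g)
  obtain ⟨l, hl₁, hl₂⟩ : ∃ l : pushout (i.map f) (i.map g) ⟶ i.obj K,
      pushout.inl _ _ ≫ l = 0 ∧ pushout.inr _ _ ≫ l = i.map k :=
    ⟨pushout.desc 0 (i.map k) (by rw [h.1, comp_zero]), pushout.inl_desc _ _ _,
      pushout.inr_desc _ _ _⟩
  have hs := IsShortExact.pushout sq h hl₁ hl₂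
  obtain ⟨P, ⟨e⟩⟩ := hext hs (i.obj_mem_essImage Z) (i.obj_mem_essImage K)
  obtain ⟨p, hp⟩ := i.map_surjective (pushout.inl _ _ ≫ e.inv)
  obtain ⟨q, hq⟩ := i.map_surjective (pushout.inr _ _ ≫ e.inv)
  obtain ⟨k', hk'⟩ := i.map_surjective (e.hom ≫ l)
  have w : f ≫ p = g ≫ q := i.map_injective (by simp [hp, hq, sq.w_assoc])
  have sq' : IsPushout (i.map f) (i.map g) (i.map p) (i.map q) :=
    IsPushout.of_iso sq (Iso.refl _) (Iso.refl _) (Iso.refl _) e.symm (by simp) (by simp)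
      (by simp [hp]) (by simp [hq])
  refine ⟨P, p, q, k', IsPushout.of_map i w sq', sq',
    hs.of_iso (Iso.refl _) e.symm (Iso.refl _) ?_ ?_, ?_⟩
  · simp [hp]
  · simp [hk']
  · exact i.map_injective (by simp [hk', hq, hl₂])

variable [Preadditive A] [i.Additive]

/-- A full subcategory of an abelian category that is closed under extensions and contains a zero
object is an exact category. -/
theorem isExactCategory_of_extensionClosed [ConflationCategory A]
    (hconf : ∀ {X Y Z : A} {f : X ⟶ Y} {g : Y ⟶ Z},
      ConflationCategory.conf f g ↔ IsShortExact (i.map f) (i.map g))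
    (hzero : ∃ Z, IsZero Z ∧ i.essImage Z)
    (hext : ∀ {X Y Z : B} {f : X ⟶ Y} {g : Y ⟶ Z}, IsShortExact f g → i.essImage X →
      i.essImage Z → i.essImage Y) : IsExactCategory A := by
  have hz {Z : A} (hZ : IsZero Z) : IsZero (i.obj Z) := by
    rw [IsZero.iff_id_eq_zero] at hZ ⊢
    rw [← i.map_id, hZ, i.map_zero]
  have h₀ : HasZeroObject A := by
    obtain ⟨Z, hZ, Z', ⟨e⟩⟩ := hzero
    refine ⟨Z', (IsZero.iff_id_eq_zero _).2 (i.map_injective ?_)⟩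
    rw [i.map_id, i.map_zero]
    exact (hZ.of_iso e).eq_of_src _ _
  have h₂ : HasBinaryBiproducts A := by
    refine ⟨fun X Y => ?_⟩
    -- Biproducts are split extensions, so the ambient biproduct lies in the subcategory.
    have hs : IsShortExact (biprod.inl : i.obj X ⟶ i.obj X ⊞ i.obj Y) biprod.snd :=
      .of_lift (by simp) fun k hk => ⟨k ≫ biprod.fst, by
        ext
        · simp
        · simp [hk]⟩
    obtain ⟨P, ⟨e⟩⟩ := hext hs (i.obj_mem_essImage X) (i.obj_mem_essImage Y)
    refine hasBinaryBiproduct_of_total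
      { pt := P
        fst := i.preimage (e.hom ≫ biprod.fst)
        snd := i.preimage (e.hom ≫ biprod.snd)
        inl := i.preimage (biprod.inl ≫ e.inv)
        inr := i.preimage (biprod.inr ≫ e.inv)
        inl_fst := i.map_injective (by simp)
        inl_snd := i.map_injective (by simp)
        inr_fst := i.map_injective (by simp)
        inr_snd := i.map_injective (by simp) } (i.map_injective ?_)
    simp only [i.map_add, i.map_comp, i.map_preimage, i.map_id, Category.assoc]
    have h := e.hom ≫= biprod.total (X := i.obj X) (Y := i.obj Y) =≫ e.inv
    simpa only [Preadditive.comp_add, Preadditive.add_comp, Category.assoc, Category.id_comp,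
      e.hom_inv_id] using h
  have : HasFiniteProducts A := hasFiniteProducts_of_has_binary_and_terminal
  have := HasFiniteBiproducts.of_hasFiniteProducts (C := A)
  refine ⟨fun {X Z} g hZ => ?_, fun {X Y Z} f g hf hg => ?_, fun f g hg => ?_,
    fun sq hg => ?_, fun {Z X} f hZ => ?_, fun {X Y Z} f g hf hg => ?_, fun f g hg => ?_,
    fun sq hg => ?_⟩
  · have : Epi (i.map g) := ⟨fun _ _ _ => (hz hZ).eq_of_src _ _⟩
    exact ⟨X, 𝟙 X, hconf.2 (.of_lift ((hz hZ).eq_of_tgt _ _) fun k _ => ⟨k, by simp⟩)⟩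
  · obtain ⟨K, k, hk⟩ := hf
    obtain ⟨L, l, hl⟩ := hg
    rw [hconf] at hk hl
    have := hk.epi
    have := hl.epi
    have := hl.mono
    -- The kernel of `f ≫ g` is the preimage under `f` of the kernel `L` of `g`: an extension of `L`
    -- by `K`.
    obtain ⟨P, p, q, k', sq, sq', -⟩ := exists_isPullback_of_extensionClosed hext l hk
    have : Mono (i.map q) :=
      ⟨fun s t e => sq'.hom_ext (by rw [← cancel_mono (i.map l)]; simp [sq'.w, reassoc_of% e]) e⟩
    have : Epi (i.map (f ≫ g)) := by rw [i.map_comp]; infer_instance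
    refine ⟨P, q, hconf.2 (.of_lift ?_ fun t ht => ?_)⟩
    · rw [← i.map_comp, ← sq.w_assoc, i.map_comp, i.map_comp, hl.1, comp_zero]
    · obtain ⟨s, hs⟩ := hl.exists_lift (t ≫ i.map f) (by simpa using ht)
      exact ⟨sq'.lift s t hs, by simp⟩
  · obtain ⟨K, k, hk⟩ := hg
    obtain ⟨P, p, q, k', sq, -⟩ := exists_isPullback_of_extensionClosed hext f (hconf.1 hk)
    exact sq.hasPullback
  · obtain ⟨K, k, hk⟩ := hg
    obtain ⟨P, p, q, k', sq', -, hs, -⟩ := exists_isPullback_of_extensionClosed hext _ (hconf.1 hk)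
    exact ⟨K, k' ≫ (sq'.isoIsPullback _ _ sq).hom, ConflationCategory.of_iso (Iso.refl _)
      (sq'.isoIsPullback _ _ sq) (Iso.refl _) (by simp) (by simp) (hconf.2 hs)⟩
  · have : Mono (i.map f) := ⟨fun _ _ _ => (hz hZ).eq_of_tgt _ _⟩
    exact ⟨X, 𝟙 X, hconf.2 (.of_desc ((hz hZ).eq_of_src _ _) fun k _ => ⟨k, by simp⟩)⟩
  · obtain ⟨K, k, hk⟩ := hf
    obtain ⟨L, l, hl⟩ := hg
    rw [hconf] at hk hl
    have := hk.mono
    have := hk.epi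
    have := hl.mono
    -- Dually, the cokernel of `f ≫ g` is the pushout of `g` along the cokernel `k` of `f`: an
    -- extension of `L` by `K`.
    obtain ⟨P, p, q, k', sq, sq', -⟩ := exists_isPushout_of_extensionClosed hext k hl
    have : Epi (i.map q) :=
      ⟨fun s t e => sq'.hom_ext (by rw [← cancel_epi (i.map k)]; simp [sq'.w_assoc, e]) e⟩
    have : Mono (i.map (f ≫ g)) := by rw [i.map_comp]; infer_instance
    refine ⟨P, q, hconf.2 (.of_desc ?_ fun t ht => ?_)⟩
    · rw [← i.map_comp, Category.assoc, ← sq.w, i.map_comp, i.map_comp, reassoc_of% hk.1,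
        zero_comp]
    · obtain ⟨s, hs⟩ := hk.exists_desc (i.map g ≫ t) (by simpa using ht)
      exact ⟨sq'.desc s t hs, by simp⟩
  · obtain ⟨K, k, hk⟩ := hg
    obtain ⟨P, p, q, k', sq, -⟩ := exists_isPushout_of_extensionClosed hext f (hconf.1 hk)
    exact sq.hasPushout
  · obtain ⟨K, k, hk⟩ := hg
    obtain ⟨P, p, q, k', sq', -, hs, -⟩ := exists_isPushout_of_extensionClosed hext _ (hconf.1 hk)
    exact ⟨K, (sq'.isoIsPushout _ _ sq).inv ≫ k', ConflationCategory.of_iso (Iso.refl _)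
      (sq'.isoIsPushout _ _ sq) (Iso.refl _) (by simp) (by simp) (hconf.2 hs)⟩

end ExtensionClosed

/-! ### Presentations tested on representables, and closure under extensions. -/

section Presentation

variable {E : Type u} [Category.{v} E] [Preadditive E] {B : Type u'} [Category.{v'} B]
  [Preadditive B] (y : E ⥤ B)

/-- `F` is the cokernel of `y.map f` as seen by morphisms from objects in the image of `y`, with
`p` the map to the cokernel. -/
structure IsPresentation {X Y : E} {F : B} (f : X ⟶ Y) (p : y.obj Y ⟶ F) : Prop where
  zero : y.map f ≫ p = 0
  lift {Z : E} (q : y.obj Z ⟶ F) : ∃ b : Z ⟶ Y, y.map b ≫ p = q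
  exact {Z : E} (b : Z ⟶ Y) : y.map b ≫ p = 0 → ∃ a : Z ⟶ X, a ≫ f = b

/-- A sequence that is short exact as seen by morphisms from objects in the image of `y`. -/
structure IsLocallyShortExact {F G H : B} (f : F ⟶ G) (g : G ⟶ H) : Prop where
  zero : f ≫ g = 0
  inj {Z : E} (q : y.obj Z ⟶ F) : q ≫ f = 0 → q = 0
  exact {Z : E} (q : y.obj Z ⟶ G) : q ≫ g = 0 → ∃ r : y.obj Z ⟶ F, r ≫ f = q
  surj {Z : E} (q : y.obj Z ⟶ H) : ∃ r : y.obj Z ⟶ G, r ≫ g = q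

variable {y}

/-- The horseshoe lemma for presentations. -/
lemma IsPresentation.horseshoe [y.Additive] {F' F F'' : B} {s : F' ⟶ F} {t : F ⟶ F''}
    (hst : IsLocallyShortExact y s t) {X' Y' X'' Y'' : E} {f' : X' ⟶ Y'} {p' : y.obj Y' ⟶ F'}
    (h' : IsPresentation y f' p') {f'' : X'' ⟶ Y''} {p'' : y.obj Y'' ⟶ F''}
    (h'' : IsPresentation y f'' p'') (P : BinaryBicone X' X'') (Q : BinaryBicone Y' Y'')
    (hQ : Q.fst ≫ Q.inl + Q.snd ≫ Q.inr = 𝟙 Q.pt) :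
    ∃ (f : P.pt ⟶ Q.pt) (p : y.obj Q.pt ⟶ F), IsPresentation y f p ∧ P.inl ≫ f = f' ≫ Q.inl ∧
      f ≫ Q.snd = P.snd ≫ f'' ∧ y.map Q.inl ≫ p = p' ≫ s ∧ p ≫ t = y.map Q.snd ≫ p'' ∧
      ∀ {K : E} (k : K ⟶ X''), k ≫ f'' = 0 → ∃ m : K ⟶ X', k ≫ P.inr ≫ f ≫ Q.fst = m ≫ f' := by
  obtain ⟨r, hr⟩ := hst.surj p''
  -- The lift `r` of `p''` need not kill `f''`. The defect `y.map f'' ≫ r` dies in `F''`, so it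
  -- comes from `F'` and lifts to `Y'`; the off-diagonal entry `h` is minus this lift.
  obtain ⟨h, hh⟩ : ∃ h : X'' ⟶ Y', y.map h ≫ p' ≫ s + y.map f'' ≫ r = 0 := by
    obtain ⟨q, hq⟩ := hst.exact (y.map f'' ≫ r) (by rw [Category.assoc, hr, h''.zero])
    obtain ⟨h, rfl⟩ := h'.lift q
    exact ⟨-h, by simp [← hq]⟩
  have hz := hst.zero
  have hz' := h'.zero
  let p : y.obj Q.pt ⟶ F := y.map Q.fst ≫ p' ≫ s + y.map Q.snd ≫ r
  have hp {Z : E} (b : Z ⟶ Q.pt) :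
      y.map b ≫ p = y.map (b ≫ Q.fst) ≫ p' ≫ s + y.map (b ≫ Q.snd) ≫ r := by simp [p]
  let f : P.pt ⟶ Q.pt := P.fst ≫ f' ≫ Q.inl + P.snd ≫ (h ≫ Q.inl + f'' ≫ Q.inr)
  have hpt : p ≫ t = y.map Q.snd ≫ p'' := by simp [p, hz, hr]
  refine ⟨f, p, ⟨?_, fun {Z} q => ?_, fun {Z} b hb => ?_⟩, by simp [f], by simp [f], ?_,
    hpt, fun {K} k hk => ?_⟩
  · have : f ≫ Q.fst = P.fst ≫ f' + P.snd ≫ h := by simp [f]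
    have : f ≫ Q.snd = P.snd ≫ f'' := by simp [f]
    simp [*, reassoc_of% hz', ← Preadditive.comp_add]
  · obtain ⟨b'', hb''⟩ := h''.lift (q ≫ t)
    obtain ⟨q', hq'⟩ := hst.exact (q - y.map b'' ≫ r) (by simp [hr, hb''])
    obtain ⟨b', rfl⟩ := h'.lift q'
    rw [Category.assoc] at hq'
    exact ⟨b' ≫ Q.inl + b'' ≫ Q.inr, by simp [hp, hq']⟩
  · have hb' := hb =≫ t
    rw [Category.assoc, hpt, zero_comp, ← Category.assoc, ← y.map_comp] at hb'
    obtain ⟨a'', ha''⟩ := h''.exact _ hb'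
    obtain ⟨a', ha'⟩ := h'.exact (b ≫ Q.fst - a'' ≫ h) (hst.inj _ (by
      rw [hp, ← ha''] at hb
      have hh' := y.map a'' ≫= hh
      simp only [Preadditive.comp_add, comp_zero, Functor.map_comp, Category.assoc, Functor.map_sub,
        Preadditive.sub_comp] at hb hh' ⊢
      rw [← sub_eq_zero.2 (hb.trans hh'.symm)]
      abel))
    refine ⟨a' ≫ P.inl + a'' ≫ P.inr, binaryBicone_hom_ext_to hQ ?_ ?_⟩
    · simp [f, ha']
    · simp [f, ha'']
  · rw [hp]; simp
  -- On the kernel of `f''` the relation `hh` reduces to the vanishing of `h ≫ p' ≫ s`. As `s` is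
  -- injective on test morphisms, `k ≫ h` is a relation for `F'`, hence factors through `f'`.
  · refine (h'.exact (k ≫ h) (hst.inj _ ?_)).imp fun m hm => by simp [f, hm]
    have := y.map k ≫= hh
    rwa [Preadditive.comp_add, ← Category.assoc (y.map k) (y.map f''), ← y.map_comp, hk, y.map_zero,
      zero_comp, add_zero, comp_zero, ← Category.assoc, ← y.map_comp, ← Category.assoc] at this

lemma exists_conf_of_isAdmissible [ConflationCategory E] {X Y : E} {f : X ⟶ Y}
    (hf : IsAdmissible f) : ∃ (K I Q : E) (k : K ⟶ X) (p : X ⟶ I) (i : I ⟶ Y) (c : Y ⟶ Q),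
      ConflationCategory.conf k p ∧ ConflationCategory.conf i c ∧ p ≫ i = f := by
  obtain ⟨I, p, i, ⟨K, k, hp⟩, ⟨Q, c, hi⟩, h⟩ := hf
  exact ⟨K, I, Q, k, p, i, c, hp, hi, h⟩

/-- An extension of objects with admissible presentations has an admissible presentation. -/
lemma exists_isPresentation_of_extension [ConflationCategory E] [IsExactCategory E] [y.Additive]
    {F' F F'' : B} {s : F' ⟶ F} {t : F ⟶ F''} (hst : IsLocallyShortExact y s t)
    {X' Y' X'' Y'' : E} {f' : X' ⟶ Y'} {p' : y.obj Y' ⟶ F'} (h' : IsPresentation y f' p')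
    (hf' : IsAdmissible f') {f'' : X'' ⟶ Y''} {p'' : y.obj Y'' ⟶ F''}
    (h'' : IsPresentation y f'' p'') (hf'' : IsAdmissible f'') :
    ∃ (X Y : E) (f : X ⟶ Y) (p : y.obj Y ⟶ F), IsAdmissible f ∧ IsPresentation y f p := by
  have := hasBinaryBiproducts_of_finite_biproducts E
  have hB : ∀ {X Y : E}, (BinaryBiproduct.bicone X Y).fst ≫ (BinaryBiproduct.bicone X Y).inl +
      (BinaryBiproduct.bicone X Y).snd ≫ (BinaryBiproduct.bicone X Y).inr = 𝟙 _ := by simp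
  obtain ⟨f, p, h, e₁, e₂, -, -, hk⟩ := IsPresentation.horseshoe hst h' h''
    (BinaryBiproduct.bicone _ _) (BinaryBiproduct.bicone _ _) hB
  obtain ⟨_, _, _, _, π', i', _, hπ', hi', rfl⟩ := exists_conf_of_isAdmissible hf'
  obtain ⟨_, _, _, k, π'', i'', _, hπ'', hi'', rfl⟩ := exists_conf_of_isAdmissible hf''
  have z := ConflationCategory.zero hπ''
  obtain ⟨m, hm⟩ := hk k (by rw [reassoc_of% z, zero_comp])
  obtain ⟨J, π, v, hπ, hv, e, -⟩ := exists_conf_of_triangular ⟨_, _, hπ'⟩ hi' hπ'' hi'' hB hB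
    (by rw [e₁, Category.assoc]) e₂ m hm
  exact ⟨_, _, f, p, ⟨J, π, v, hπ, hv, e⟩, h⟩

end Presentation

/-! ### Functors `Eᵒᵖ ⥤ Ab`: pointwise criteria, the Yoneda lemma, additivity. -/

section Functors

open Opposite

variable {E : Type u} [Category.{v} E]

lemma exact_iff_app {F G H : Eᵒᵖ ⥤ AddCommGrpCat.{v}} {f : F ⟶ G} {g : G ⟶ H} (w : f ≫ g = 0) :
    (ShortComplex.mk f g w).Exact ↔ ∀ Z x, g.app Z x = 0 → ∃ z, f.app Z z = x := by
  refine ⟨fun h Z => (ShortComplex.ab_exact_iff _).1 (h.map ((evaluation _ _).obj Z)),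
    fun h => ?_⟩
  rw [ShortComplex.exact_iff_isZero_homology]
  refine Functor.isZero _ fun Z => ?_
  have : ((ShortComplex.mk f g w).map ((evaluation _ _).obj Z)).Exact :=
    (ShortComplex.ab_exact_iff _).2 (h Z)
  exact ((ShortComplex.exact_iff_isZero_homology _).1 this).of_iso
    ((ShortComplex.mk f g w).mapHomologyIso ((evaluation _ _).obj Z)).symm

lemma epi_iff_app {F G : Eᵒᵖ ⥤ AddCommGrpCat.{v}} {f : F ⟶ G} :
    Epi f ↔ ∀ Z, Function.Surjective (f.app Z) :=
  (NatTrans.epi_iff_epi_app f).trans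
    (forall_congr' fun Z => AddCommGrpCat.epi_iff_surjective (f.app Z))

lemma mono_iff_app {F G : Eᵒᵖ ⥤ AddCommGrpCat.{v}} {f : F ⟶ G} :
    Mono f ↔ ∀ Z, Function.Injective (f.app Z) :=
  (NatTrans.mono_iff_mono_app f).trans
    (forall_congr' fun Z => AddCommGrpCat.mono_iff_injective (f.app Z))

lemma isShortExact_iff_app {F G H : Eᵒᵖ ⥤ AddCommGrpCat.{v}} {f : F ⟶ G} {g : G ⟶ H} :
    IsShortExact f g ↔ f ≫ g = 0 ∧ ∀ Z, Function.Injective (f.app Z) ∧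
      (∀ x, g.app Z x = 0 → ∃ z, f.app Z z = x) ∧ Function.Surjective (g.app Z) :=
  ⟨fun ⟨w, h⟩ => ⟨w, fun Z => ⟨mono_iff_app.1 h.mono_f Z, (exact_iff_app w).1 h.exact Z,
      epi_iff_app.1 h.epi_g Z⟩⟩,
    fun ⟨w, h⟩ => ⟨w, { exact := (exact_iff_app w).2 fun Z => (h Z).2.1
                        mono_f := mono_iff_app.2 fun Z => (h Z).1
                        epi_g := epi_iff_app.2 fun Z => (h Z).2.2 }⟩⟩

variable [Preadditive E]

/-- The morphism from a representable functor to an additive functor given by the Yoneda lemma. -/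
def yonedaHomMk (F : Eᵒᵖ ⥤ AddCommGrpCat.{v}) [F.Additive] {Z : E} (x : F.obj (op Z)) :
    preadditiveYoneda.obj Z ⟶ F where
  app W := AddCommGrpCat.ofHom
    { toFun := fun (g : W.unop ⟶ Z) => F.map g.op x
      map_zero' := by
        change F.map (0 : W.unop ⟶ Z).op x = 0
        rw [op_zero, F.map_zero]
        rfl
      map_add' := fun (g h : W.unop ⟶ Z) => by
        change F.map (g + h).op x = F.map g.op x + F.map h.op x
        rw [op_add, F.map_add]
        rfl }
  naturality := fun W W' a => by
    ext (g : W.unop ⟶ Z)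
    change F.map (a.unop ≫ g).op x = F.map a (F.map g.op x)
    rw [op_comp, F.map_comp]
    rfl

lemma yonedaHomMk_id (F : Eᵒᵖ ⥤ AddCommGrpCat.{v}) [F.Additive] {Z : E} (x : F.obj (op Z)) :
    (yonedaHomMk F x).app (op Z) (𝟙 Z) = x := by
  change F.map (𝟙 (op Z)) x = x
  rw [F.map_id]
  rfl

lemma yonedaHom_app {F : Eᵒᵖ ⥤ AddCommGrpCat.{v}} {Z : E} (q : preadditiveYoneda.obj Z ⟶ F)
    {W : Eᵒᵖ} (g : W.unop ⟶ Z) : q.app W g = F.map g.op (q.app (op Z) (𝟙 Z)) := by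
  have h := congr($(q.naturality g.op) (𝟙 Z))
  have hg : (preadditiveYoneda.obj Z).map g.op (𝟙 Z) = g := Category.comp_id g
  exact (congrArg (q.app W) hg).symm.trans h

lemma yonedaHom_ext {F : Eᵒᵖ ⥤ AddCommGrpCat.{v}} {Z : E} {q r : preadditiveYoneda.obj Z ⟶ F}
    (h : q.app (op Z) (𝟙 Z) = r.app (op Z) (𝟙 Z)) : q = r := by
  ext W (g : W.unop ⟶ Z)
  exact (yonedaHom_app q g).trans (((congrArg (F.map g.op) h)).trans (yonedaHom_app r g).symm)

lemma additive_of_epi {F G : Eᵒᵖ ⥤ AddCommGrpCat.{v}} [F.Additive] (p : F ⟶ G) [Epi p] :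
    G.Additive where
  map_add {Z W a b} := by
    ext x
    obtain ⟨x, rfl⟩ := (AddCommGrpCat.epi_iff_surjective (p.app Z)).1 inferInstance x
    have nat (c : Z ⟶ W) : G.map c (p.app Z x) = p.app W (F.map c x) :=
      (congr($(p.naturality c) x)).symm
    change G.map (a + b) (p.app Z x) = G.map a (p.app Z x) + G.map b (p.app Z x)
    rw [nat, nat, nat, F.map_add]
    exact map_add (p.app W).hom _ _

/-- Extensions of additive functors are additive. -/
lemma additive_of_isShortExact [HasFiniteBiproducts E] {F G H : Eᵒᵖ ⥤ AddCommGrpCat.{v}}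
    [F.Additive] [H.Additive] {f : F ⟶ G} {g : G ⟶ H} (h : IsShortExact f g) : G.Additive := by
  have := hasBinaryBiproducts_of_finite_biproducts E
  obtain ⟨Z₀, hZ₀⟩ := hasZeroObject_of_hasFiniteBiproducts E
  have h' := (isShortExact_iff_app.1 h).2
  have natf {Z W : Eᵒᵖ} (c : Z ⟶ W) (x) : G.map c (f.app Z x) = f.app W (F.map c x) :=
    (congr($(f.naturality c) x)).symm
  have natg {Z W : Eᵒᵖ} (c : Z ⟶ W) (x) : H.map c (g.app Z x) = g.app W (G.map c x) :=
    (congr($(g.naturality c) x)).symm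
  have Gcomp {Z W V : E} (a : Z ⟶ W) (b : W ⟶ V) (x : G.obj (op V)) :
      G.map a.op (G.map b.op x) = G.map (a ≫ b).op x := by rw [op_comp, G.map_comp]; rfl
  have Gid {Z : E} (x : G.obj (op Z)) : G.map (𝟙 Z).op x = x := by rw [op_id, G.map_id]; rfl
  -- If the `a j` and `b j` decompose the identity of `Z`, then restriction along the `a j` is
  -- jointly injective on values of an additive functor. Unlike additivity itself, this passes
  -- directly to extensions, by a diagram chase through `H` and then `F`.
  have jointly {Z : E} {ι : Type} [Fintype ι] {W : ι → E} (a : ∀ j, W j ⟶ Z) (b : ∀ j, Z ⟶ W j)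
      (hab : ∑ j, b j ≫ a j = 𝟙 Z) (x : G.obj (op Z)) (hx : ∀ j, G.map (a j).op x = 0) :
      x = 0 := by
    have key (K : Eᵒᵖ ⥤ AddCommGrpCat.{v}) [K.Additive] (z : K.obj (op Z))
        (hz : ∀ j, K.map (a j).op z = 0) : z = 0 := by
      let φ : (Z ⟶ Z) →+ K.obj (op Z) := ((yonedaHomMk K z).app (op Z)).hom
      rw [← yonedaHomMk_id K z]
      change φ (𝟙 Z) = 0
      rw [← hab, map_sum]
      refine Finset.sum_eq_zero fun j _ => ?_
      change K.map (b j ≫ a j).op z = 0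
      rw [op_comp, K.map_comp, ConcreteCategory.comp_apply, hz, map_zero]
    obtain ⟨z, rfl⟩ := (h' _).2.1 x (key H _ fun j => by rw [natg, hx, map_zero])
    rw [key F z fun j => (h' _).1 (by rw [← natf, hx, map_zero]), map_zero]
  -- A zero map factors through `Z₀`, whose identity is the empty sum, so `jointly` gives `G(Z₀) =
  -- 0`.
  have G0 {Z W : E} (x : G.obj (op Z)) : G.map (0 : W ⟶ Z).op x = 0 := by
    rw [← comp_zero (X := W) (f := (0 : W ⟶ Z₀)), ← Gcomp,
      jointly (ι := Empty) (W := fun _ => Z₀) (fun j => j.elim) (fun j => j.elim)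
      (hZ₀.eq_of_src _ _) (G.map (0 : Z₀ ⟶ Z).op x) (fun j => j.elim), map_zero]
  -- The universal case of additivity, tested on the two inclusions into `Z ⊞ Z`. Every sum of two
  -- morphisms is a pullback of it along `biprod.lift`.
  have Gadd {Z : E} (x : G.obj (op Z)) : G.map (biprod.fst + biprod.snd : Z ⊞ Z ⟶ Z).op x =
      G.map (biprod.fst : Z ⊞ Z ⟶ Z).op x + G.map (biprod.snd : Z ⊞ Z ⟶ Z).op x := by
    rw [← sub_eq_zero]
    refine jointly (ι := Bool) (W := fun _ => Z) (fun j => bif j then biprod.inl else biprod.inr)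
      (fun j => bif j then biprod.fst else biprod.snd) (by simp) _ ?_
    have aux (c : Z ⟶ Z ⊞ Z) : G.map c.op (G.map (biprod.fst + biprod.snd : Z ⊞ Z ⟶ Z).op x -
        (G.map (biprod.fst : Z ⊞ Z ⟶ Z).op x + G.map (biprod.snd : Z ⊞ Z ⟶ Z).op x)) =
        G.map (c ≫ (biprod.fst + biprod.snd)).op x -
          (G.map (c ≫ biprod.fst).op x + G.map (c ≫ biprod.snd).op x) := by
      rw [map_sub, map_add, Gcomp, Gcomp, Gcomp]
    rintro (_ | _)
    · change G.map biprod.inr.op _ = 0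
      rw [aux, Preadditive.comp_add, biprod.inr_fst, biprod.inr_snd, zero_add, Gid, G0, zero_add,
        sub_self]
    · change G.map biprod.inl.op _ = 0
      rw [aux, Preadditive.comp_add, biprod.inl_fst, biprod.inl_snd, add_zero, Gid, G0, add_zero,
        sub_self]
  refine ⟨fun {Z W a b} => ?_⟩
  ext x
  have e : a + b = (biprod.lift a.unop b.unop ≫ (biprod.fst + biprod.snd)).op := by simp
  change G.map (a + b) x = G.map a x + G.map b x
  rw [e, ← Gcomp, Gadd, map_add, Gcomp, Gcomp]
  simp

/-- Representables are projective: an element of `H` lifts pointwise to `G`, and the Yoneda lemma,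
available because `G` is additive, makes the lift a morphism. -/
lemma IsShortExact.isLocallyShortExact {F G H : Eᵒᵖ ⥤ AddCommGrpCat.{v}} [G.Additive]
    {f : F ⟶ G} {g : G ⟶ H} (h : IsShortExact f g) :
    IsLocallyShortExact preadditiveYoneda f g where
  zero := h.1
  inj q hq := by
    have := h.mono
    rwa [← cancel_mono f, zero_comp]
  exact q hq := h.exists_lift q hq
  surj {Z} q := by
    obtain ⟨x, hx⟩ := ((isShortExact_iff_app.1 h).2 (op Z)).2.2 (q.app (op Z) (𝟙 Z))
    exact ⟨yonedaHomMk G x, yonedaHom_ext ((congrArg _ (yonedaHomMk_id G x)).trans hx)⟩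

/-- Elements of additive functors are morphisms out of representables, so each pointwise condition
is one of the test conditions. -/
lemma IsLocallyShortExact.isShortExact {F G H : Eᵒᵖ ⥤ AddCommGrpCat.{v}} [F.Additive] [G.Additive]
    [H.Additive] {f : F ⟶ G} {g : G ⟶ H} (h : IsLocallyShortExact preadditiveYoneda f g) :
    IsShortExact f g := by
  refine isShortExact_iff_app.2 ⟨h.zero, fun Z => ⟨?_, fun x hx => ?_, fun x => ?_⟩⟩
  · refine (injective_iff_map_eq_zero (f.app Z).hom).2 fun x hx => ?_
    have := h.inj (yonedaHomMk F (Z := Z.unop) x) (yonedaHom_ext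
      ((congrArg _ (yonedaHomMk_id F (Z := Z.unop) x)).trans hx))
    rw [← yonedaHomMk_id F (Z := Z.unop) x, this]
    rfl
  · obtain ⟨r, hr⟩ := h.exact (yonedaHomMk G (Z := Z.unop) x) (yonedaHom_ext
      ((congrArg _ (yonedaHomMk_id G (Z := Z.unop) x)).trans hx))
    refine ⟨r.app Z (𝟙 Z.unop), ?_⟩
    rw [← yonedaHomMk_id G (Z := Z.unop) x, ← hr]
    rfl
  · obtain ⟨r, hr⟩ := h.surj (yonedaHomMk H (Z := Z.unop) x)
    refine ⟨r.app Z (𝟙 Z.unop), ?_⟩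
    rw [← yonedaHomMk_id H (Z := Z.unop) x, ← hr]
    rfl

end Functors

/-! ### Transfer of the test conditions along a functor compatible with the two embeddings of `E`.
-/

section Transfer

variable {E : Type u} [Category.{v} E] {A : Type u'} [Category.{v'} A]
  [Preadditive A] {B : Type*} [Category* B] [Preadditive B] {y : E ⥤ A} {y' : E ⥤ B} {i : A ⥤ B}
  [i.Faithful] [i.Additive]

/-- Needed because `SmodAdm E` is not literally a category of functors: its Yoneda embedding agrees
with the usual one only up to isomorphism after inclusion. -/
lemma IsPresentation.map [i.Full] (e : y ⋙ i ≅ y') {X Y : E} {F : A} {f : X ⟶ Y} {p : y.obj Y ⟶ F}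
    (h : IsPresentation y f p) : IsPresentation y' f (e.inv.app Y ≫ i.map p) where
  zero := by
    have := e.inv.naturality f
    simp only [Functor.comp_map] at this
    rw [reassoc_of% this, ← i.map_comp, h.zero, i.map_zero, comp_zero]
  lift {Z} q := by
    obtain ⟨b, hb⟩ := h.lift (i.preimage (e.hom.app Z ≫ q))
    have := e.inv.naturality b
    simp only [Functor.comp_map] at this
    exact ⟨b, by rw [reassoc_of% this, ← i.map_comp, hb, i.map_preimage, e.inv_hom_id_app_assoc]⟩
  exact {Z} b hb := by
    have := e.inv.naturality b
    simp only [Functor.comp_map] at this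
    refine h.exact b (i.map_injective ?_)
    rw [reassoc_of% this, ← i.map_comp] at hb
    rw [← cancel_epi (e.inv.app Z), hb, i.map_zero, comp_zero]

lemma IsPresentation.of_map (e : y ⋙ i ≅ y') {X Y : E} {F : A} {f : X ⟶ Y} {p : y.obj Y ⟶ F}
    (h : IsPresentation y' f (e.inv.app Y ≫ i.map p)) : IsPresentation y f p := by
  have nat {Z W : E} (b : Z ⟶ W) : y'.map b ≫ e.inv.app W = e.inv.app Z ≫ i.map (y.map b) :=
    e.inv.naturality b
  refine ⟨i.map_injective ?_, fun {Z} q => ?_, fun {Z} b hb => h.exact b ?_⟩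
  · have := h.zero
    rw [reassoc_of% nat, ← i.map_comp] at this
    rw [← cancel_epi (e.inv.app X), this, i.map_zero, comp_zero]
  · obtain ⟨b, hb⟩ := h.lift (e.inv.app Z ≫ i.map q)
    refine ⟨b, i.map_injective ?_⟩
    rw [← cancel_epi (e.inv.app Z), ← hb, reassoc_of% nat, i.map_comp]
  · rw [reassoc_of% nat, ← i.map_comp, hb, i.map_zero, comp_zero]

lemma isLocallyShortExact_map_iff [i.Full] (e : y ⋙ i ≅ y') {F G H : A} {f : F ⟶ G} {g : G ⟶ H} :
    IsLocallyShortExact y' (i.map f) (i.map g) ↔ IsLocallyShortExact y f g := by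
  have lift {Z : E} {F : A} (q : y'.obj Z ⟶ i.obj F) :
      ∃ r : y.obj Z ⟶ F, q = e.inv.app Z ≫ i.map r := ⟨i.preimage (e.hom.app Z ≫ q), by simp⟩
  constructor
  · intro h
    refine ⟨i.map_injective (by rw [i.map_comp, h.zero, i.map_zero]), fun {Z} q hq => ?_,
      fun {Z} q hq => ?_, fun {Z} q => ?_⟩
    · have := h.inj (e.inv.app Z ≫ i.map q) (by
        rw [Category.assoc, ← i.map_comp, hq, i.map_zero, comp_zero])
      exact i.map_injective (by rw [← cancel_epi (e.inv.app Z), this, i.map_zero, comp_zero])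
    · obtain ⟨r, hr⟩ := h.exact (e.inv.app Z ≫ i.map q) (by
        rw [Category.assoc, ← i.map_comp, hq, i.map_zero, comp_zero])
      obtain ⟨r, rfl⟩ := lift r
      exact ⟨r, i.map_injective (by rw [← cancel_epi (e.inv.app Z), ← hr]; simp)⟩
    · obtain ⟨r, hr⟩ := h.surj (e.inv.app Z ≫ i.map q)
      obtain ⟨r, rfl⟩ := lift r
      exact ⟨r, i.map_injective (by rw [← cancel_epi (e.inv.app Z), ← hr]; simp)⟩
  · intro h
    refine ⟨by rw [← i.map_comp, h.zero, i.map_zero], fun {Z} q hq => ?_, fun {Z} q hq => ?_,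
      fun {Z} q => ?_⟩
    · obtain ⟨q, rfl⟩ := lift q
      rw [Category.assoc, ← i.map_comp] at hq
      rw [h.inj q (i.map_injective (by rw [← cancel_epi (e.inv.app Z), hq]; simp)), i.map_zero,
        comp_zero]
    · obtain ⟨q, rfl⟩ := lift q
      rw [Category.assoc, ← i.map_comp] at hq
      obtain ⟨r, rfl⟩ := h.exact q
        (i.map_injective (by rw [← cancel_epi (e.inv.app Z), hq]; simp))
      exact ⟨e.inv.app Z ≫ i.map r, by simp⟩
    · obtain ⟨q, rfl⟩ := lift q
      obtain ⟨r, rfl⟩ := h.surj q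
      exact ⟨e.inv.app Z ≫ i.map r, by simp⟩

end Transfer

/-! ### Admissibly presented functors are closed under extensions. -/

section Functors

open Opposite

variable {E : Type u} [Category.{v} E] [Preadditive E]

instance additive_preadditiveYoneda :
    (preadditiveYoneda : E ⥤ Eᵒᵖ ⥤ AddCommGrpCat.{v}).Additive where
  map_add {X Y f g} := by
    ext Z (h : Z.unop ⟶ X)
    exact Preadditive.comp_add _ _ _ h f g

lemma isPresentation_of_exact {X Y : E} {F : Eᵒᵖ ⥤ AddCommGrpCat.{v}} {f : X ⟶ Y}
    {p : preadditiveYoneda.obj Y ⟶ F} (w : preadditiveYoneda.map f ≫ p = 0)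
    (h : (ShortComplex.mk (preadditiveYoneda.map f) p w).Exact) [Epi p] :
    IsPresentation preadditiveYoneda f p where
  zero := w
  lift {Z} q := by
    obtain ⟨b, hb⟩ := epi_iff_app.1 ‹Epi p› (op Z) (q.app (op Z) (𝟙 Z))
    exact ⟨b, yonedaHom_ext ((congrArg (p.app (op Z)) (Category.id_comp (X := Z) b)).trans hb)⟩
  exact {Z} b hb := by
    refine (exact_iff_app w).1 h (op Z) b ?_
    refine (congrArg (p.app (op Z)) (Category.id_comp (X := Z) b)).symm.trans ?_
    exact congr((NatTrans.app $hb (op Z)) (𝟙 Z))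

lemma IsPresentation.epi {X Y : E} {F : Eᵒᵖ ⥤ AddCommGrpCat.{v}} [F.Additive] {f : X ⟶ Y}
    {p : preadditiveYoneda.obj Y ⟶ F} (h : IsPresentation preadditiveYoneda f p) : Epi p := by
  refine epi_iff_app.2 fun Z x => ?_
  obtain ⟨b, hb⟩ := h.lift (yonedaHomMk F (Z := Z.unop) x)
  refine ⟨b, ?_⟩
  rw [← yonedaHomMk_id F (Z := Z.unop) x, ← hb]
  exact (congrArg (p.app Z) (Category.id_comp (X := Z.unop) b)).symm

lemma IsPresentation.shortComplex_exact {X Y : E} {F : Eᵒᵖ ⥤ AddCommGrpCat.{v}}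
    {f : X ⟶ Y} {p : preadditiveYoneda.obj Y ⟶ F} (h : IsPresentation preadditiveYoneda f p) :
    (ShortComplex.mk (preadditiveYoneda.map f) p h.zero).Exact := by
  refine (exact_iff_app h.zero).2 fun Z b hb => ?_
  refine h.exact (Z := Z.unop) b (yonedaHom_ext ?_)
  exact (congrArg (p.app Z) (Category.id_comp (X := Z.unop) b)).trans hb

variable [ConflationCategory E]

/-- Quotients of representables are additive. Conversely, additivity has to be required explicitly,
since the test conditions see `F` only through morphisms out of representables, which give all its
elements when `F` is additive. -/
lemma isAdmPresented_iff {F : Eᵒᵖ ⥤ AddCommGrpCat.{v}} :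
    isAdmPresented E F ↔ F.Additive ∧ ∃ (X Y : E) (f : X ⟶ Y) (p : preadditiveYoneda.obj Y ⟶ F),
      IsAdmissible f ∧ IsPresentation preadditiveYoneda f p := by
  constructor
  · rintro ⟨X, Y, f, hf, p, w, h, hp⟩
    exact ⟨additive_of_epi p, X, Y, f, p, hf, isPresentation_of_exact w h⟩
  · rintro ⟨_, X, Y, f, p, hf, h⟩
    exact ⟨X, Y, f, hf, p, h.zero, h.shortComplex_exact, h.epi⟩

lemma isAdmPresented_of_isShortExact [IsExactCategory E] {F G H : Eᵒᵖ ⥤ AddCommGrpCat.{v}}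
    {f : F ⟶ G} {g : G ⟶ H} (h : IsShortExact f g) (hF : isAdmPresented E F)
    (hH : isAdmPresented E H) : isAdmPresented E G := by
  obtain ⟨_, _, _, _, _, h₁, h₁'⟩ := isAdmPresented_iff.1 hF
  obtain ⟨_, _, _, _, _, h₂, h₂'⟩ := isAdmPresented_iff.1 hH
  have := additive_of_isShortExact h
  exact isAdmPresented_iff.2 ⟨this,
    exists_isPresentation_of_extension h.isLocallyShortExact h₁' h₁ h₂' h₂⟩

lemma isAdmPresented_of_iso {F G : Eᵒᵖ ⥤ AddCommGrpCat.{v}} (e : F ≅ G)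
    (hF : isAdmPresented E F) : isAdmPresented E G := by
  obtain ⟨X, Y, f, hf, p, w, h, hp⟩ := hF
  refine ⟨X, Y, f, hf, p ≫ e.hom, by rw [reassoc_of% w, zero_comp], ?_, inferInstance⟩
  exact ShortComplex.exact_of_iso (S₁ := .mk _ p w)
    (ShortComplex.isoMk (Iso.refl (preadditiveYoneda.obj X)) (Iso.refl (preadditiveYoneda.obj Y)) e) h

variable (E) in
lemma essImage_incl_iff {F : Eᵒᵖ ⥤ AddCommGrpCat.{v}} :
    (SmodAdm.incl E).essImage F ↔ isAdmPresented E F := by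
  constructor
  · rintro ⟨G, ⟨e⟩⟩
    exact isAdmPresented_of_iso e ((SmodAdm.equivalence E).inverse.obj G).property
  · intro hF
    exact ⟨(SmodAdm.equivalence E).functor.obj ⟨F, hF⟩,
      ⟨(isAdmPresented E).ι.mapIso ((SmodAdm.equivalence E).unitIso.app ⟨F, hF⟩).symm⟩⟩

instance isExactCategory_smodAdm [IsExactCategory E] : IsExactCategory (SmodAdm E) := by
  refine isExactCategory_of_extensionClosed (i := SmodAdm.incl E) Iff.rfl ?_
    fun h h₁ h₂ => ?_
  · obtain ⟨Z, hZ⟩ := hasZeroObject_of_hasFiniteBiproducts E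
    refine ⟨preadditiveYoneda.obj Z, ?_, (essImage_incl_iff E).2 (isAdmPresented_yoneda Z)⟩
    rw [IsZero.iff_id_eq_zero] at hZ ⊢
    rw [← preadditiveYoneda.map_id, hZ, Functor.map_zero]
  · rw [essImage_incl_iff] at h₁ h₂ ⊢
    exact isAdmPresented_of_isShortExact h h₁ h₂

end Functors

/-! ### Conflations and presentations in `SmodAdm E`; the Yoneda embedding is left exact. -/

section SmodAdm

variable {E : Type u} [Category.{v} E] [Preadditive E] [ConflationCategory E]

instance additive_incl_obj (F : SmodAdm E) : ((SmodAdm.incl E).obj F).Additive :=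
  (isAdmPresented_iff.1 ((essImage_incl_iff E).1 ((SmodAdm.incl E).obj_mem_essImage F))).1

variable [IsExactCategory E]

variable (E) in
/-- The Yoneda embedding into `SmodAdm E` is the restriction of the Yoneda embedding. -/
noncomputable def yonedaAdmCompIncl : yonedaAdm E ⋙ SmodAdm.incl E ≅ preadditiveYoneda :=
  Functor.isoWhiskerLeft ((isAdmPresented E).lift preadditiveYoneda isAdmPresented_yoneda)
    (Functor.isoWhiskerRight (SmodAdm.equivalence E).unitIso.symm (isAdmPresented E).ι)

instance : (yonedaAdm E).Faithful := Functor.Faithful.of_comp_iso (yonedaAdmCompIncl E)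

instance : (yonedaAdm E).Full :=
  have : (yonedaAdm E ⋙ SmodAdm.incl E).Full := Functor.Full.of_iso (yonedaAdmCompIncl E).symm
  Functor.Full.of_comp_faithful _ (SmodAdm.incl E)

instance : (yonedaAdm E).Additive :=
  have : (yonedaAdm E ⋙ SmodAdm.incl E).Additive :=
    Functor.additive_of_iso (yonedaAdmCompIncl E).symm
  Functor.additive_of_comp_faithful _ (SmodAdm.incl E)

/-- Objects of `SmodAdm E` are additive functors, so short exactness may be tested on
representables. Later arguments about conflations use only this form. -/
lemma conf_iff_isLocallyShortExact {F G H : SmodAdm E} {f : F ⟶ G} {g : G ⟶ H} :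
    ConflationCategory.conf f g ↔ IsLocallyShortExact (yonedaAdm E) f g := by
  rw [← isLocallyShortExact_map_iff (yonedaAdmCompIncl E)]
  exact ⟨fun h => IsShortExact.isLocallyShortExact h, fun h => h.isShortExact⟩

lemma exists_isPresentation (F : SmodAdm E) :
    ∃ (X Y : E) (f : X ⟶ Y) (p : (yonedaAdm E).obj Y ⟶ F), IsAdmissible f ∧
      IsPresentation (yonedaAdm E) f p := by
  obtain ⟨-, X, Y, f, p, hf, h⟩ := isAdmPresented_iff.1 ((essImage_incl_iff E).1
    ((SmodAdm.incl E).obj_mem_essImage F))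
  refine ⟨X, Y, f, (SmodAdm.incl E).preimage ((yonedaAdmCompIncl E).hom.app Y ≫ p), hf, ?_⟩
  exact IsPresentation.of_map (yonedaAdmCompIncl E) (by simpa using h)

lemma exists_isPresentation_of_isAdmissible {X Y : E} {f : X ⟶ Y} (hf : IsAdmissible f) :
    ∃ (F : SmodAdm E) (p : (yonedaAdm E).obj Y ⟶ F), IsPresentation (yonedaAdm E) f p := by
  let p := cokernel.π (preadditiveYoneda.map f)
  have w : preadditiveYoneda.map f ≫ p = 0 := cokernel.condition _
  have h : (ShortComplex.mk _ p w).Exact :=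
    ShortComplex.exact_of_g_is_cokernel _ (cokernelIsCokernel _)
  obtain ⟨F, ⟨e⟩⟩ := (essImage_incl_iff E).2 ⟨X, Y, f, hf, p, w, h, inferInstance⟩
  refine ⟨F, (SmodAdm.incl E).preimage ((yonedaAdmCompIncl E).hom.app Y ≫ p ≫ e.inv),
    IsPresentation.of_map (yonedaAdmCompIncl E) ?_⟩
  have w' : preadditiveYoneda.map f ≫ p ≫ e.inv = 0 := by rw [reassoc_of% w, zero_comp]
  have h' := isPresentation_of_exact w' (ShortComplex.exact_of_iso
    (S₁ := .mk _ p w) (ShortComplex.isoMk (Iso.refl (preadditiveYoneda.obj X))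
      (Iso.refl (preadditiveYoneda.obj Y)) e.symm) h)
  simpa using h'

variable {X Y : E} {F : SmodAdm E} {f : X ⟶ Y} {p : (yonedaAdm E).obj Y ⟶ F}

lemma epi_of_isPresentation (h : IsPresentation (yonedaAdm E) f p) : Epi p := by
  have h' := (h.map (yonedaAdmCompIncl E)).epi
  have : Epi ((SmodAdm.incl E).map p) := epi_of_epi ((yonedaAdmCompIncl E).inv.app Y) _
  exact (SmodAdm.incl E).epi_of_epi_map this

lemma exists_desc_of_isPresentation (h : IsPresentation (yonedaAdm E) f p) {G : SmodAdm E}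
    (r : (yonedaAdm E).obj Y ⟶ G) (hr : (yonedaAdm E).map f ≫ r = 0) : ∃ s : F ⟶ G, p ≫ s = r := by
  have h' := h.map (yonedaAdmCompIncl E)
  have := h'.epi
  have nat := (yonedaAdmCompIncl E).inv.naturality f
  simp only [Functor.comp_map] at nat
  obtain ⟨s, hs⟩ := CokernelCofork.IsColimit.desc' h'.shortComplex_exact.gIsCokernel
    ((yonedaAdmCompIncl E).inv.app Y ≫ (SmodAdm.incl E).map r) (by
      dsimp only
      rw [reassoc_of% nat, ← Functor.map_comp, hr, Functor.map_zero, comp_zero])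
  refine ⟨(SmodAdm.incl E).preimage s, (SmodAdm.incl E).map_injective ?_⟩
  rw [← cancel_epi ((yonedaAdmCompIncl E).inv.app Y), ← hs]
  simp

/-- The Yoneda embedding turns a morphism with a cokernel presented by it into a deflation
followed by an inflation. -/
lemma IsPresentation.exists_conf (h : IsPresentation (yonedaAdm E) f p) {K : E} {k : K ⟶ X}
    [Mono k] (hk : IsAdmissible k) (w : k ≫ f = 0)
    (hkf : ∀ {Z : E} (b : Z ⟶ X), b ≫ f = 0 → ∃ a : Z ⟶ K, a ≫ k = b) :
    ∃ (M : SmodAdm E) (q : (yonedaAdm E).obj X ⟶ M) (j : M ⟶ (yonedaAdm E).obj Y),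
      ConflationCategory.conf ((yonedaAdm E).map k) q ∧ ConflationCategory.conf j p ∧
        q ≫ j = (yonedaAdm E).map f := by
  -- The image of `Hom(-, f)` is the quotient of `Hom(-, X)` by `Hom(-, K)`. It is admissibly
  -- presented because `k` is admissible.
  obtain ⟨M, q, hq⟩ := exists_isPresentation_of_isAdmissible hk
  obtain ⟨j, hj⟩ := exists_desc_of_isPresentation hq ((yonedaAdm E).map f)
    (by rw [← Functor.map_comp, w, Functor.map_zero])
  have := epi_of_isPresentation hq
  refine ⟨M, q, j, conf_iff_isLocallyShortExact.2 ⟨hq.zero, fun {Z} r hr => ?_, fun {Z} r hr => ?_,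
    fun {Z} r => ?_⟩, conf_iff_isLocallyShortExact.2 ⟨?_, fun {Z} r hr => ?_, fun {Z} r hr => ?_,
    fun {Z} r => ?_⟩, hj⟩
  · obtain ⟨b, rfl⟩ := (yonedaAdm E).map_surjective r
    have : b ≫ k = 0 := (yonedaAdm E).map_injective (by simpa using hr)
    rw [zero_of_comp_mono k this, Functor.map_zero]
  · obtain ⟨b, rfl⟩ := (yonedaAdm E).map_surjective r
    obtain ⟨a, rfl⟩ := hq.exact b hr
    exact ⟨(yonedaAdm E).map a, by simp⟩
  · obtain ⟨b, rfl⟩ := hq.lift r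
    exact ⟨_, rfl⟩
  · rw [← cancel_epi q, reassoc_of% hj, h.zero, comp_zero]
  · obtain ⟨b, rfl⟩ := hq.lift r
    obtain ⟨a, rfl⟩ := hkf b ((yonedaAdm E).map_injective (by
      rw [Functor.map_comp, ← hj, ← Category.assoc, hr, Functor.map_zero]))
    rw [Functor.map_comp, Category.assoc, hq.zero, comp_zero]
  · obtain ⟨b, rfl⟩ := (yonedaAdm E).map_surjective r
    obtain ⟨a, rfl⟩ := h.exact b hr
    exact ⟨(yonedaAdm E).map a ≫ q, by simp [hj]⟩
  · obtain ⟨b, rfl⟩ := h.lift r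
    exact ⟨_, rfl⟩

lemma isAdmissible_of_isInflation {X Y : E} {f : X ⟶ Y} (hf : IsInflation f) :
    IsAdmissible f := ⟨X, 𝟙 X, f, isDeflation_id X, hf, by simp⟩

lemma isAdmissible_of_isDeflation {X Y : E} {f : X ⟶ Y} (hf : IsDeflation f) :
    IsAdmissible f := ⟨Y, f, 𝟙 Y, hf, isInflation_id Y, by simp⟩

variable (E) in
theorem isLeftExactFunctor_yonedaAdm : IsLeftExactFunctor (yonedaAdm E) := by
  have key {X Y Z : E} {f : X ⟶ Y} {g : Y ⟶ Z} (h : ConflationCategory.conf f g) :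
      ∃ (M : SmodAdm E) (q : (yonedaAdm E).obj Y ⟶ M) (j : M ⟶ (yonedaAdm E).obj Z),
        ConflationCategory.conf ((yonedaAdm E).map f) q ∧ IsInflation j ∧
          q ≫ j = (yonedaAdm E).map g := by
    -- Here `F` is the cokernel of `Hom(-, g)`, generally nonzero. Both `g` and its kernel `f` are
    -- admissible, so the image and the cokernel of `Hom(-, g)` lie in `SmodAdm E`.
    obtain ⟨F, p, hp⟩ := exists_isPresentation_of_isAdmissible
      (isAdmissible_of_isDeflation ⟨_, _, h⟩)
    have := mono_of_conf h
    obtain ⟨M, q, j, h₁, h₂, e⟩ := hp.exists_conf (isAdmissible_of_isInflation ⟨_, _, h⟩)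
      (ConflationCategory.zero h) fun b hb => conf_lift h b hb
    exact ⟨M, q, j, h₁, ⟨_, _, h₂⟩, e⟩
  refine ⟨inferInstance, fun h => ?_, fun h => ?_, fun h => ?_⟩ <;>
    obtain ⟨M, q, j, h₁, h₂, e⟩ := key h
  · exact ⟨_, _, h₁⟩
  · exact ⟨M, q, j, ⟨_, _, h₁⟩, h₂, e⟩
  · have := mono_of_isInflation h₂
    have := mono_of_conf h₁
    have z := ConflationCategory.zero h₁
    refine ⟨by rw [← e, reassoc_of% z, zero_comp], ⟨KernelFork.IsLimit.ofι' _ _ fun k hk => ?_⟩⟩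
    rw [← e, ← Category.assoc] at hk
    exact ⟨_, (conf_lift h₁ k (by rw [← cancel_mono j, hk, zero_comp])).choose_spec⟩

end SmodAdm

/-! ### Cokernels of admissible morphisms. -/

section AdmissibleCokernel

variable {D : Type u} [Category.{v} D] [Preadditive D] [ConflationCategory D]

/-- `f` is admissible and `c` is its cokernel. -/
def IsAdmissibleCokernel {X Y Q : D} (f : X ⟶ Y) (c : Y ⟶ Q) : Prop :=
  ∃ (I : D) (p : X ⟶ I) (i : I ⟶ Y), IsDeflation p ∧ ConflationCategory.conf i c ∧ p ≫ i = f

namespace IsAdmissibleCokernel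

variable {X Y Q : D} {f : X ⟶ Y} {c : Y ⟶ Q}

lemma zero (h : IsAdmissibleCokernel f c) : f ≫ c = 0 := by
  obtain ⟨I, p, i, -, h, rfl⟩ := h
  rw [Category.assoc, ConflationCategory.zero h, comp_zero]

lemma epi (h : IsAdmissibleCokernel f c) : Epi c := by
  obtain ⟨I, p, i, -, h, rfl⟩ := h
  exact epi_of_conf h

lemma exists_desc (h : IsAdmissibleCokernel f c) {T : D} (k : Y ⟶ T) (hk : f ≫ k = 0) :
    ∃ l : Q ⟶ T, c ≫ l = k := by
  obtain ⟨I, p, i, hp, h, rfl⟩ := h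
  have := epi_of_isDeflation hp
  exact conf_desc h k (by rw [← cancel_epi p, ← Category.assoc, hk, comp_zero])

/-- Since `p` is epi, `i` and `f` have the same cokernel. Hence any deflation-inflation
factorisation of `f` may replace the one hidden in `h`. -/
lemma conf_of_fac (h : IsAdmissibleCokernel f c) {I : D} {p : X ⟶ I} {i : I ⟶ Y}
    (hp : IsDeflation p) (hi : IsInflation i) (e : p ≫ i = f) : ConflationCategory.conf i c := by
  have := h.epi
  have := epi_of_isDeflation hp
  have z := h.zero
  refine conf_of_desc hi (by rw [← cancel_epi p, reassoc_of% e, z, comp_zero]) fun k hk => ?_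
  exact h.exists_desc k (by rw [← e, Category.assoc, hk, comp_zero])

end IsAdmissibleCokernel

lemma IsAdmissible.exists_isAdmissibleCokernel {X Y : D} {f : X ⟶ Y} (hf : IsAdmissible f) :
    ∃ (Q : D) (c : Y ⟶ Q), IsAdmissibleCokernel f c := by
  obtain ⟨I, p, i, hp, ⟨Q, c, h⟩, e⟩ := hf
  exact ⟨Q, c, I, p, i, hp, h, e⟩

end AdmissibleCokernel

/-! ### Extending left exact functors to `SmodAdm E`, and uniqueness of the extension. -/

section Extension

variable {E : Type u} [Category.{v} E] [Preadditive E] [ConflationCategory E]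
  {D : Type u'} [Category.{v'} D] [Preadditive D] [ConflationCategory D]

/-- `Φ.map π` need not be a deflation, so the image `J` may differ from `Φ.obj I`. What survives is
that `Φ.map k` is the kernel of the new deflation; inflations compose, so the rest is again an
inflation. -/
lemma IsLeftExactFunctor.exists_conf_of_factorization [IsExactCategory D] {Φ : E ⥤ D}
    (hΦ : IsLeftExactFunctor Φ) {K X I Y : E} {k : K ⟶ X} {π : X ⟶ I} {i : I ⟶ Y}
    (h : ConflationCategory.conf k π) (hi : IsInflation i) :
    ∃ (J : D) (p : Φ.obj X ⟶ J) (j : J ⟶ Φ.obj Y), ConflationCategory.conf (Φ.map k) p ∧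
      IsInflation j ∧ p ≫ j = Φ.map (π ≫ i) := by
  obtain ⟨J, p, j, hp, hj, e⟩ := hΦ.exists_conf h
  obtain ⟨_, _, hi⟩ := hi
  exact ⟨J, p, j ≫ Φ.map i, hp, IsExactCategory.inflation_comp _ _ hj (hΦ.map_inflation hi),
    by rw [reassoc_of% e, Φ.map_comp]⟩

lemma IsLeftExactFunctor.map_isAdmissible [IsExactCategory D] {Φ : E ⥤ D}
    (hΦ : IsLeftExactFunctor Φ) {X Y : E} {f : X ⟶ Y} (hf : IsAdmissible f) :
    IsAdmissible (Φ.map f) := by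
  obtain ⟨I, p, i, ⟨_, _, hp⟩, hi, rfl⟩ := hf
  obtain ⟨J, q, j, hq, hj, e⟩ := hΦ.exists_conf_of_factorization hp hi
  exact ⟨J, q, j, ⟨_, _, hq⟩, hj, e⟩

variable [IsExactCategory E]

/-- A presentation of `F` together with a cokernel of the image of this presentation under `Φ`. -/
structure CokernelDatum (Φ : E ⥤ D) (F : SmodAdm E) where
  {X Y : E}
  {f : X ⟶ Y}
  {p : (yonedaAdm E).obj Y ⟶ F}
  admissible : IsAdmissible f
  presentation : IsPresentation (yonedaAdm E) f p
  {Q : D}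
  {c : Φ.obj Y ⟶ Q}
  cokernel : IsAdmissibleCokernel (Φ.map f) c

namespace CokernelDatum

variable {Φ : E ⥤ D} {F F' F'' : SmodAdm E}

/-- Two lifts of one morphism differ by a multiple of `R.f`, whose image under `Φ` is killed by
`R.c`. -/
lemma map_comp_c_eq [Φ.Additive] (R : CokernelDatum Φ F) {Z : E} {b b' : Z ⟶ R.Y}
    (h : (yonedaAdm E).map b ≫ R.p = (yonedaAdm E).map b' ≫ R.p) :
    Φ.map b ≫ R.c = Φ.map b' ≫ R.c := by
  obtain ⟨a, ha⟩ := R.presentation.exact (b - b') (by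
    rw [Functor.map_sub, Preadditive.sub_comp, h, sub_self])
  rw [← sub_eq_zero, ← Preadditive.sub_comp, ← Φ.map_sub, ← ha, Φ.map_comp, Category.assoc,
    R.cokernel.zero, comp_zero]

/-- Comparison of presentations by lifting. Quantifying over all lifts `b` allows the induced map to
be computed from any convenient one. -/
lemma exists_map [Φ.Additive] (R : CokernelDatum Φ F) (R' : CokernelDatum Φ F') (a : F ⟶ F') :
    ∃ l : R.Q ⟶ R'.Q, ∀ b : R.Y ⟶ R'.Y, (yonedaAdm E).map b ≫ R'.p = R.p ≫ a →
      R.c ≫ l = Φ.map b ≫ R'.c := by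
  obtain ⟨b, hb⟩ := R'.presentation.lift (R.p ≫ a)
  have z := R.presentation.zero
  obtain ⟨g, hg⟩ := R'.presentation.exact (R.f ≫ b) (by
    rw [Functor.map_comp, Category.assoc, hb, reassoc_of% z, zero_comp])
  obtain ⟨l, hl⟩ := R.cokernel.exists_desc (Φ.map b ≫ R'.c) (by
    rw [← Category.assoc, ← Φ.map_comp, ← hg, Φ.map_comp, Category.assoc, R'.cokernel.zero,
      comp_zero])
  exact ⟨l, fun b' hb' => hl.trans (R'.map_comp_c_eq (hb.trans hb'.symm))⟩

/-- The morphism between cokernels induced by a morphism of presented objects. -/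
noncomputable def map [Φ.Additive] (R : CokernelDatum Φ F) (R' : CokernelDatum Φ F') (a : F ⟶ F') :
    R.Q ⟶ R'.Q := (R.exists_map R' a).choose

variable [Φ.Additive]

lemma c_map (R : CokernelDatum Φ F) (R' : CokernelDatum Φ F') {a : F ⟶ F'} {b : R.Y ⟶ R'.Y}
    (h : (yonedaAdm E).map b ≫ R'.p = R.p ≫ a) : R.c ≫ R.map R' a = Φ.map b ≫ R'.c :=
  (R.exists_map R' a).choose_spec b h

lemma map_eq (R : CokernelDatum Φ F) (R' : CokernelDatum Φ F') {a : F ⟶ F'} {b : R.Y ⟶ R'.Y}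
    (h : (yonedaAdm E).map b ≫ R'.p = R.p ≫ a) {l : R.Q ⟶ R'.Q}
    (hl : R.c ≫ l = Φ.map b ≫ R'.c) : R.map R' a = l := by
  have := R.cokernel.epi
  rw [← cancel_epi R.c, hl, R.c_map R' h]

@[simp]
lemma map_id (R : CokernelDatum Φ F) : R.map R (𝟙 F) = 𝟙 _ :=
  R.map_eq R (b := 𝟙 _) (by simp) (by simp)

lemma map_comp (R : CokernelDatum Φ F) (R' : CokernelDatum Φ F') (R'' : CokernelDatum Φ F'')
    (a : F ⟶ F') (a' : F' ⟶ F'') : R.map R' a ≫ R'.map R'' a' = R.map R'' (a ≫ a') := by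
  obtain ⟨b, hb⟩ := R'.presentation.lift (R.p ≫ a)
  obtain ⟨b', hb'⟩ := R''.presentation.lift (R'.p ≫ a')
  refine (R.map_eq R'' (b := b ≫ b') ?_ ?_).symm
  · rw [Functor.map_comp, Category.assoc, hb', reassoc_of% hb]
  · rw [← Category.assoc, R.c_map R' hb, Category.assoc, R'.c_map R'' hb', Φ.map_comp,
      Category.assoc]

lemma map_add (R : CokernelDatum Φ F) (R' : CokernelDatum Φ F') (a a' : F ⟶ F') :
    R.map R' (a + a') = R.map R' a + R.map R' a' := by
  obtain ⟨b, hb⟩ := R'.presentation.lift (R.p ≫ a)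
  obtain ⟨b', hb'⟩ := R'.presentation.lift (R.p ≫ a')
  refine R.map_eq R' (b := b + b') ?_ ?_
  · rw [Functor.map_add, Preadditive.add_comp, Preadditive.comp_add, hb, hb']
  · rw [Preadditive.comp_add, R.c_map R' hb, R.c_map R' hb', Φ.map_add, Preadditive.add_comp]

/-- Cokernels of different presentations of isomorphic objects are isomorphic. -/
noncomputable def mapIso (R : CokernelDatum Φ F) (R' : CokernelDatum Φ F') (a : F ≅ F') :
    R.Q ≅ R'.Q where
  hom := R.map R' a.hom
  inv := R'.map R a.inv
  hom_inv_id := by rw [map_comp, Iso.hom_inv_id, map_id]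
  inv_hom_id := by rw [map_comp, Iso.inv_hom_id, map_id]

variable [IsExactCategory D]

variable (Φ) in
/-- The presentation of a representable functor by the zero morphism. -/
lemma exists_ofYoneda (Y : E) :
    ∃ (X : E) (f : X ⟶ Y), IsAdmissible f ∧
      IsPresentation (yonedaAdm E) f (𝟙 ((yonedaAdm E).obj Y)) ∧
      IsAdmissibleCokernel (Φ.map f) (𝟙 (Φ.obj Y)) := by
  obtain ⟨Z, hZ⟩ := hasZeroObject_of_hasFiniteBiproducts E
  have hZ' : IsZero (Φ.obj Z) := by
    rw [IsZero.iff_id_eq_zero] at hZ ⊢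
    rw [← Φ.map_id, hZ, Φ.map_zero]
  refine ⟨Z, 0, isAdmissible_of_isInflation (IsExactCategory.inflation_from_zero _ hZ),
    ⟨by simp, fun q => ⟨(yonedaAdm E).preimage q, by simp⟩, fun b hb => ⟨0, ?_⟩⟩,
    _, 𝟙 _, 0, isDeflation_id _, ?_, by simp⟩
  · exact (yonedaAdm E).map_injective (by simpa using hb.symm)
  · exact conf_of_desc (IsExactCategory.inflation_from_zero _ hZ') (by simp) fun k _ => ⟨k, by simp⟩

variable (Φ) in
/-- The cokernel datum for a representable functor given by the presentation by zero. -/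
noncomputable def ofYoneda (Y : E) : CokernelDatum Φ ((yonedaAdm E).obj Y) where
  admissible := (exists_ofYoneda Φ Y).choose_spec.choose_spec.1
  presentation := (exists_ofYoneda Φ Y).choose_spec.choose_spec.2.1
  cokernel := (exists_ofYoneda Φ Y).choose_spec.choose_spec.2.2

lemma ofYoneda_map {Y Y' : E} (b : Y ⟶ Y') :
    (ofYoneda Φ Y).map (ofYoneda Φ Y') ((yonedaAdm E).map b) = Φ.map b :=
  map_eq (ofYoneda Φ Y) (ofYoneda Φ Y') (b := b)
    ((Category.comp_id _).trans (Category.id_comp _).symm)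
    ((Category.id_comp _).trans (Category.comp_id _).symm)

/-- A conflation has presentations such that the cokernels of their images form a conflation. -/
lemma exists_conf (hΦ : IsLeftExactFunctor Φ) {s : F' ⟶ F} {t : F ⟶ F''}
    (h : ConflationCategory.conf s t) (R' : CokernelDatum Φ F') (R'' : CokernelDatum Φ F'') :
    ∃ R : CokernelDatum Φ F, ConflationCategory.conf (R'.map R s) (R.map R'' t) := by
  have := hasBinaryBiproducts_of_finite_biproducts E
  obtain ⟨B, hB⟩ : ∃ B : BinaryBicone R'.X R''.X, B.fst ≫ B.inl + B.snd ≫ B.inr = 𝟙 B.pt :=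
    ⟨BinaryBiproduct.bicone _ _, by simp⟩
  obtain ⟨C, hC⟩ : ∃ C : BinaryBicone R'.Y R''.Y, C.fst ≫ C.inl + C.snd ≫ C.inr = 𝟙 C.pt :=
    ⟨BinaryBiproduct.bicone _ _, by simp⟩
  obtain ⟨f, p, hp, e₁, e₂, e₃, e₄, hk⟩ := IsPresentation.horseshoe
    (conf_iff_isLocallyShortExact.1 h) R'.presentation R''.presentation B C hC
  obtain ⟨_, I', _, k', π', i', _, hk', hi', e'⟩ := exists_conf_of_isAdmissible R'.admissible
  obtain ⟨K, I'', _, k, π'', i'', _, hk'', hi'', e''⟩ :=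
    exists_conf_of_isAdmissible R''.admissible
  have z := ConflationCategory.zero hk''
  obtain ⟨m, hm⟩ := hk k (by rw [← e'', reassoc_of% z, zero_comp])
  -- First use of the triangular lemma, in `E`: the horseshoe presentation is admissible.
  have hf : IsAdmissible f := by
    obtain ⟨J, π, v, hπ, hv, e, -⟩ := exists_conf_of_triangular ⟨_, _, hk'⟩ hi' hk'' hi'' hB hC
      (by rw [e₁, ← e', Category.assoc]) (by rw [e₂, ← e'']) m (by rw [hm, e'])
    exact ⟨J, π, v, hπ, hv, e⟩
  obtain ⟨J', q', j', hq', hj', a'⟩ := hΦ.exists_conf_of_factorization hk' ⟨_, _, hi'⟩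
  obtain ⟨J'', q'', j'', hq'', hj'', a''⟩ := hΦ.exists_conf_of_factorization hk'' ⟨_, _, hi''⟩
  rw [e'] at a'
  rw [e''] at a''
  have hB' := congr(Φ.map $hB)
  have hC' := congr(Φ.map $hC)
  simp only [Φ.map_add, Φ.map_comp, Φ.map_id] at hB' hC'
  -- Second use, in `D`, on `Φ.map f`. The kernel of the deflation part of the image of `R''.f` is
  -- `Φ.map k`, so `Φ.map m` is the required factorisation of the off-diagonal entry.
  obtain ⟨J, π, v, hπ, hv, e, H⟩ := exists_conf_of_triangular (B := Φ.mapBinaryBicone B)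
    (D := Φ.mapBinaryBicone C) (f := Φ.map f) ⟨_, _, hq'⟩
    (R'.cokernel.conf_of_fac ⟨_, _, hq'⟩ hj' a') hq''
    (R''.cokernel.conf_of_fac ⟨_, _, hq''⟩ hj'' a'') hB' hC'
    (by
      rw [reassoc_of% a']
      have h := congr(Φ.map $e₁)
      rw [Φ.map_comp, Φ.map_comp] at h
      exact h)
    (by
      rw [a'']
      have h := congr(Φ.map $e₂)
      rw [Φ.map_comp, Φ.map_comp] at h
      exact h) (Φ.map m)
    (by
      rw [a']
      have h := congr(Φ.map $hm)
      rw [Φ.map_comp, Φ.map_comp, Φ.map_comp, Φ.map_comp] at h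
      exact h)
  obtain ⟨Q, c, hc⟩ := hv
  obtain ⟨s', t', hst, hs, ht⟩ := H c hc
  let R : CokernelDatum Φ F := ⟨hf, hp, ⟨J, π, v, hπ, hc, e⟩⟩
  refine ⟨R, ?_⟩
  rwa [R'.map_eq R (b := C.inl) e₃ hs, R.map_eq R'' (b := C.snd) e₄.symm ht]

end CokernelDatum

/-- The presentation splits into two conflations of `SmodAdm E`, both preserved by `Ψ`. Hence the
value of `Ψ` at `F` is forced by its values on representables. -/
lemma IsPresentation.isAdmissibleCokernel_map {X Y : E} {F : SmodAdm E} {f : X ⟶ Y}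
    {p : (yonedaAdm E).obj Y ⟶ F} (h : IsPresentation (yonedaAdm E) f p) (hf : IsAdmissible f)
    {Ψ : SmodAdm E ⥤ D} (hΨ : IsExactFunctor Ψ) :
    IsAdmissibleCokernel (Ψ.map ((yonedaAdm E).map f)) (Ψ.map p) := by
  obtain ⟨K, I, _, k, π, i, _, hk, hi, e⟩ := exists_conf_of_isAdmissible hf
  have := mono_of_conf hk
  have := mono_of_conf hi
  have z := ConflationCategory.zero hk
  obtain ⟨M, q, j, hq, hj, e'⟩ := h.exists_conf (isAdmissible_of_isInflation ⟨_, _, hk⟩)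
    (by rw [← e, reassoc_of% z, zero_comp]) fun b hb => conf_lift hk b (by
      rw [← cancel_mono i, Category.assoc, e, hb, zero_comp])
  exact ⟨_, Ψ.map q, Ψ.map j, ⟨_, _, hΨ.map_conf hq⟩, hΨ.map_conf hj, by rw [← Ψ.map_comp, e']⟩

lemma IsExactFunctor.natTrans_ext {Ψ Ψ' : SmodAdm E ⥤ D} (hΨ : IsExactFunctor Ψ) {σ τ : Ψ ⟶ Ψ'}
    (h : ∀ Y, σ.app ((yonedaAdm E).obj Y) = τ.app ((yonedaAdm E).obj Y)) : σ = τ := by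
  ext F
  obtain ⟨X, Y, f, p, hf, hp⟩ := exists_isPresentation F
  have := (hp.isAdmissibleCokernel_map hf hΨ).epi
  rw [← cancel_epi (Ψ.map p), σ.naturality, τ.naturality, h]

/-- Natural transformations out of an exact functor extend uniquely from representable functors. -/
lemma IsExactFunctor.exists_natTrans {Ψ Ψ' : SmodAdm E ⥤ D} (hΨ : IsExactFunctor Ψ)
    (hΨ' : Ψ'.Additive) (γ : yonedaAdm E ⋙ Ψ ⟶ yonedaAdm E ⋙ Ψ') :
    ∃ δ : Ψ ⟶ Ψ', Functor.whiskerLeft (yonedaAdm E) δ = γ := by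
  have nat {Z Y : E} (b : Z ⟶ Y) : Ψ.map ((yonedaAdm E).map b) ≫ γ.app Y =
      γ.app Z ≫ Ψ'.map ((yonedaAdm E).map b) := γ.naturality b
  -- Asking for compatibility with every morphism from a representable, not only with a chosen
  -- presentation, makes naturality independent of choices.
  have key (F : SmodAdm E) : ∃ l : Ψ.obj F ⟶ Ψ'.obj F, ∀ {Z : E} (q : (yonedaAdm E).obj Z ⟶ F),
      Ψ.map q ≫ l = γ.app Z ≫ Ψ'.map q := by
    obtain ⟨X, Y, f, p, hf, hp⟩ := exists_isPresentation F
    obtain ⟨l, hl⟩ := (hp.isAdmissibleCokernel_map hf hΨ).exists_desc (γ.app Y ≫ Ψ'.map p) (by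
      rw [reassoc_of% nat, ← Ψ'.map_comp, hp.zero, Ψ'.map_zero, comp_zero])
    refine ⟨l, fun {Z} q => ?_⟩
    obtain ⟨b, rfl⟩ := hp.lift q
    rw [Ψ.map_comp, Category.assoc, hl, reassoc_of% nat, Ψ'.map_comp]
  choose l hl using key
  refine ⟨{ app := l, naturality := fun F G a => ?_ }, ?_⟩
  · obtain ⟨X, Y, f, p, hf, hp⟩ := exists_isPresentation F
    have := (hp.isAdmissibleCokernel_map hf hΨ).epi
    rw [← cancel_epi (Ψ.map p), ← Category.assoc, ← Ψ.map_comp, hl, ← Category.assoc, hl,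
      Ψ'.map_comp, Category.assoc]
  · ext Y
    simpa using hl ((yonedaAdm E).obj Y) (𝟙 _)

/-- Isomorphisms between exact functors extend uniquely from representable functors. -/
lemma IsExactFunctor.exists_natIso {Ψ Ψ' : SmodAdm E ⥤ D} (hΨ : IsExactFunctor Ψ)
    (hΨ' : IsExactFunctor Ψ') (γ : yonedaAdm E ⋙ Ψ ≅ yonedaAdm E ⋙ Ψ') :
    ∃ δ : Ψ ≅ Ψ', Functor.isoWhiskerLeft (yonedaAdm E) δ = γ := by
  obtain ⟨δ, hδ⟩ := hΨ.exists_natTrans hΨ'.additive γ.hom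
  obtain ⟨δ', hδ'⟩ := hΨ'.exists_natTrans hΨ.additive γ.inv
  have h (Y) : δ.app ((yonedaAdm E).obj Y) = γ.hom.app Y := congr(NatTrans.app $hδ Y)
  have h' (Y) : δ'.app ((yonedaAdm E).obj Y) = γ.inv.app Y := congr(NatTrans.app $hδ' Y)
  refine ⟨⟨δ, δ', hΨ.natTrans_ext fun Y => ?_, hΨ'.natTrans_ext fun Y => ?_⟩, Iso.ext hδ⟩
  · rw [NatTrans.comp_app, h, h', Iso.hom_inv_id_app]
    rfl
  · rw [NatTrans.comp_app, h, h', Iso.inv_hom_id_app]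
    rfl

lemma IsExactFunctor.existsUnique_natIso {Ψ Ψ' : SmodAdm E ⥤ D} (hΨ : IsExactFunctor Ψ)
    (hΨ' : IsExactFunctor Ψ') {Φ : E ⥤ D} (α : yonedaAdm E ⋙ Ψ ≅ Φ) (α' : yonedaAdm E ⋙ Ψ' ≅ Φ) :
    ∃! β : Ψ ≅ Ψ', Functor.isoWhiskerLeft (yonedaAdm E) β ≪≫ α' = α := by
  obtain ⟨β, hβ⟩ := hΨ.exists_natIso hΨ' (α ≪≫ α'.symm)
  refine ⟨β, by simp [hβ], fun β' hβ' => Iso.ext (hΨ.natTrans_ext fun Y => ?_)⟩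
  have h := congr(($hβ').hom.app Y)
  have h' := congr(($hβ).hom.app Y)
  simp only [Iso.trans_hom, NatTrans.comp_app, Functor.isoWhiskerLeft_hom,
    Functor.whiskerLeft_app, Iso.symm_hom] at h h'
  rw [h', ← h]
  simp

lemma IsExactFunctor.of_iso {C : Type*} [Category* C] [Preadditive C] [ConflationCategory C]
    {F G : C ⥤ D} (e : F ≅ G) (hF : IsExactFunctor F) : IsExactFunctor G where
  additive :=
    have := hF.additive
    Functor.additive_of_iso e
  map_conf h := ConflationCategory.of_iso (e.app _) (e.app _) (e.app _) (e.hom.naturality _)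
    (e.hom.naturality _) (hF.map_conf h)

variable [IsExactCategory D]

lemma IsLeftExactFunctor.nonempty_cokernelDatum {Φ : E ⥤ D} (hΦ : IsLeftExactFunctor Φ)
    (F : SmodAdm E) : Nonempty (CokernelDatum Φ F) := by
  obtain ⟨X, Y, f, p, hf, h⟩ := exists_isPresentation F
  obtain ⟨Q, c, hc⟩ := (hΦ.map_isAdmissible hf).exists_isAdmissibleCokernel
  exact ⟨⟨hf, h, hc⟩⟩

/-- A choice of cokernel data for a left exact functor. -/
noncomputable def IsLeftExactFunctor.cokernelDatum {Φ : E ⥤ D} (hΦ : IsLeftExactFunctor Φ)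
    (F : SmodAdm E) : CokernelDatum Φ F := (hΦ.nonempty_cokernelDatum F).some

/-- The extension of a left exact functor to `SmodAdm E`, given by the cokernels of the images
of presentations. -/
noncomputable def IsLeftExactFunctor.extension {Φ : E ⥤ D} (hΦ : IsLeftExactFunctor Φ) :
    SmodAdm E ⥤ D :=
  have := hΦ.additive
  { obj := fun F => (hΦ.cokernelDatum F).Q
    map := fun a => (hΦ.cokernelDatum _).map (hΦ.cokernelDatum _) a
    map_id := fun _ => CokernelDatum.map_id _
    map_comp := fun _ _ => (CokernelDatum.map_comp _ _ _ _ _).symm }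

/-- The extension of a left exact functor restricts to the given functor. -/
noncomputable def IsLeftExactFunctor.extensionIso {Φ : E ⥤ D} (hΦ : IsLeftExactFunctor Φ) :
    yonedaAdm E ⋙ hΦ.extension ≅ Φ :=
  have := hΦ.additive
  NatIso.ofComponents (fun Y => (hΦ.cokernelDatum _).mapIso (.ofYoneda Φ Y) (Iso.refl _))
    fun {Y Y'} b => by
      rw [← CokernelDatum.ofYoneda_map (Φ := Φ) b]
      change CokernelDatum.map _ _ _ ≫ CokernelDatum.map _ _ _ =
        CokernelDatum.map _ _ _ ≫ CokernelDatum.map _ _ _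
      rw [CokernelDatum.map_comp, CokernelDatum.map_comp]
      simp

lemma IsLeftExactFunctor.isExactFunctor_extension {Φ : E ⥤ D} (hΦ : IsLeftExactFunctor Φ) :
    IsExactFunctor hΦ.extension where
  additive := by
    have := hΦ.additive
    exact ⟨CokernelDatum.map_add _ _ _ _⟩
  map_conf {F' F F'' s t} h := by
    have := hΦ.additive
    obtain ⟨R, hR⟩ := CokernelDatum.exists_conf hΦ h (hΦ.cokernelDatum F') (hΦ.cokernelDatum F'')
    refine ConflationCategory.of_iso (Iso.refl _) (R.mapIso (hΦ.cokernelDatum F) (Iso.refl F))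
      (Iso.refl _) ?_ ?_ hR
    · change CokernelDatum.map _ _ _ ≫ CokernelDatum.map _ _ _ =
        𝟙 _ ≫ CokernelDatum.map _ _ _
      rw [CokernelDatum.map_comp, Category.id_comp]
      simp
    · change CokernelDatum.map _ _ _ ≫ 𝟙 _ = CokernelDatum.map _ _ _ ≫ CokernelDatum.map _ _ _
      rw [CokernelDatum.map_comp, Category.comp_id]
      simp

/-- A functor that restricts to `Φ` along a functor that is injective on objects up to isomorphism
is isomorphic to a functor that restricts to `Φ` on the nose. -/
lemma exists_iso_comp_eq {C A D : Type*} [Category* C] [Category* A] [Category* D] {y : C ⥤ A}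
    (hy : Function.Injective y.obj) {Ψ : A ⥤ D} {Φ : C ⥤ D} (e : y ⋙ Ψ ≅ Φ) :
    ∃ Ψ' : A ⥤ D, Nonempty (Ψ ≅ Ψ') ∧ y ⋙ Ψ' = Φ := by
  classical
  -- Replace the value of `Ψ` at each `y.obj Y` by `Φ.obj Y`, via `e`, and keep it elsewhere.
  -- Injectivity makes the chosen preimage of `y.obj Y` equal to `Y`.
  obtain ⟨s, hs⟩ : ∃ s : ∀ F, Σ Q : D, Ψ.obj F ≅ Q, ∀ Y, s (y.obj Y) = ⟨Φ.obj Y, e.app Y⟩ := by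
    refine ⟨fun F => if h : ∃ Y, y.obj Y = F then
      ⟨Φ.obj h.choose, Ψ.mapIso (eqToIso h.choose_spec.symm) ≪≫ e.app h.choose⟩
      else ⟨_, Iso.refl _⟩, fun Y => ?_⟩
    have h : ∃ Z, y.obj Z = y.obj Y := ⟨Y, rfl⟩
    dsimp only
    rw [dif_pos h]
    have key (Z : C) (h : y.obj Z = y.obj Y) : (⟨Φ.obj Z, Ψ.mapIso (eqToIso h.symm) ≪≫ e.app Z⟩ :
        Σ Q : D, Ψ.obj (y.obj Y) ≅ Q) = ⟨Φ.obj Y, e.app Y⟩ := by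
      obtain rfl := hy h
      simp
    exact key _ h.choose_spec
  refine ⟨Ψ.copyObj (fun F => (s F).1) fun F => (s F).2, ⟨Ψ.isoCopyObj _ _⟩, ?_⟩
  refine Functor.hext (fun Y => congrArg Sigma.fst (hs Y)) fun Y Z b => ?_
  -- The new objects agree with those of `Φ` only propositionally. Generalising over the pairs of
  -- object and isomorphism allows substitution of these equalities.
  have key : ∀ (a : Σ Q : D, Ψ.obj (y.obj Y) ≅ Q) (c : Σ Q : D, Ψ.obj (y.obj Z) ≅ Q),
      a = ⟨Φ.obj Y, e.app Y⟩ → c = ⟨Φ.obj Z, e.app Z⟩ →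
        HEq (a.2.inv ≫ Ψ.map (y.map b) ≫ c.2.hom) (Φ.map b) := by
    rintro _ _ rfl rfl
    have := e.hom.naturality b
    simp only [Functor.comp_map] at this
    simp [this]
  exact key _ _ (hs Y) (hs Z)

end Extension

/-! ### The pseudofunctor `mod_adm(-)`. -/

section Pseudofunctor

open ExactBicat Bicategory

/-- `SmodAdm E` as an object of `Ex`. -/
noncomputable abbrev smodObj (E : ExL.{w}) : Ex.{w} := smodAdmObj E isExactCategory_smodAdm

/-- This reduces every coherence law to representables, where the structure maps are explicit in
terms of `smodMapIso`. -/
lemma smodObj_hom₂_ext {E : ExL.{w}} {X : Ex.{w}} {F G : smodObj E ⟶ X} {σ τ : F ⟶ G}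
    (h : ∀ Y, (natTrans σ).app ((yonedaAdm E.cat.carrier).obj Y) =
      (natTrans τ).app ((yonedaAdm E.cat.carrier).obj Y)) : σ = τ :=
  ObjectProperty.hom_ext _ (IsExactFunctor.natTrans_ext (E := E.cat.carrier)
    (ObjectProperty.FullSubcategory.property F) h)

section

variable {E E' E'' : ExL.{w}}

lemma isLeftExactFunctor_comp_yonedaAdm (Φ : E ⟶ E') :
    IsLeftExactFunctor (functor Φ ⋙ yonedaAdm E'.cat.carrier) :=
  IsLeftExactFunctor.comp (E := SmodAdm E'.cat.carrier) (ObjectProperty.FullSubcategory.property Φ)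
    (isLeftExactFunctor_yonedaAdm _)

/-- The exact functor between categories of admissibly presented functors induced by a left exact
functor. -/
noncomputable def smodMap (Φ : E ⟶ E') : SmodAdm E.cat.carrier ⥤ SmodAdm E'.cat.carrier :=
  (isLeftExactFunctor_comp_yonedaAdm Φ).extension

lemma isExactFunctor_smodMap (Φ : E ⟶ E') : IsExactFunctor (smodMap Φ) :=
  (isLeftExactFunctor_comp_yonedaAdm Φ).isExactFunctor_extension

/-- `smodMap Φ` extends `Φ`. -/
noncomputable def smodMapIso (Φ : E ⟶ E') : yonedaAdm E.cat.carrier ⋙ smodMap Φ ≅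
    functor Φ ⋙ yonedaAdm E'.cat.carrier :=
  (isLeftExactFunctor_comp_yonedaAdm Φ).extensionIso

/-- The value on representables is forced by naturality of `smodMapIso`. The identity and
composition constraints are obtained in the same way. -/
lemma exists_smodMap₂ {Φ Φ' : E ⟶ E'} (η : Φ ⟶ Φ') : ∃ σ : smodMap Φ ⟶ smodMap Φ',
    Functor.whiskerLeft (yonedaAdm _) σ = (smodMapIso Φ).hom ≫
      Functor.whiskerRight (natTrans η) (yonedaAdm _) ≫ (smodMapIso Φ').inv :=
  (isExactFunctor_smodMap Φ).exists_natTrans (isExactFunctor_smodMap Φ').additive _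

/-- The natural transformation between exact functors induced by one between left exact
functors. -/
noncomputable def smodMap₂ {Φ Φ' : E ⟶ E'} (η : Φ ⟶ Φ') : smodMap Φ ⟶ smodMap Φ' :=
  (exists_smodMap₂ η).choose

lemma smodMap₂_app {Φ Φ' : E ⟶ E'} (η : Φ ⟶ Φ') (X : E.cat.carrier) :
    (smodMap₂ η).app ((yonedaAdm _).obj X) = (smodMapIso Φ).hom.app X ≫
      (yonedaAdm _).map ((natTrans η).app X) ≫ (smodMapIso Φ').inv.app X :=
  congr(NatTrans.app $((exists_smodMap₂ η).choose_spec) X)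

lemma exists_smodMapId (E : ExL.{w}) : ∃ σ : smodMap (𝟙 E) ≅ 𝟭 _,
    Functor.isoWhiskerLeft (yonedaAdm _) σ = smodMapIso (𝟙 E) :=
  (isExactFunctor_smodMap (𝟙 E)).exists_natIso .id (smodMapIso (𝟙 E))

/-- `smodMap` preserves identities up to isomorphism. -/
noncomputable def smodMapId (E : ExL.{w}) : smodMap (𝟙 E) ≅ 𝟭 _ :=
  (exists_smodMapId E).choose

lemma smodMapId_hom_app (X : E.cat.carrier) :
    (smodMapId E).hom.app ((yonedaAdm _).obj X) = (smodMapIso (𝟙 E)).hom.app X :=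
  congr(NatTrans.app (Iso.hom $((exists_smodMapId E).choose_spec)) X)

lemma exists_smodMapComp (Φ : E ⟶ E') (Φ' : E' ⟶ E'') :
    ∃ σ : smodMap (Φ ≫ Φ') ≅ smodMap Φ ⋙ smodMap Φ',
      Functor.isoWhiskerLeft (yonedaAdm _) σ = smodMapIso (Φ ≫ Φ') ≪≫
        Functor.isoWhiskerLeft (functor Φ) (smodMapIso Φ').symm ≪≫
          Functor.isoWhiskerRight (smodMapIso Φ).symm (smodMap Φ') :=
  (isExactFunctor_smodMap (Φ ≫ Φ')).exists_natIso
    ((isExactFunctor_smodMap Φ).comp (isExactFunctor_smodMap Φ')) _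

/-- `smodMap` preserves compositions up to isomorphism. -/
noncomputable def smodMapComp (Φ : E ⟶ E') (Φ' : E' ⟶ E'') :
    smodMap (Φ ≫ Φ') ≅ smodMap Φ ⋙ smodMap Φ' :=
  (exists_smodMapComp Φ Φ').choose

lemma smodMapComp_hom_app (Φ : E ⟶ E') (Φ' : E' ⟶ E'') (X : E.cat.carrier) :
    (smodMapComp Φ Φ').hom.app ((yonedaAdm _).obj X) = (smodMapIso (Φ ≫ Φ')).hom.app X ≫
      (smodMapIso Φ').inv.app ((functor Φ).obj X) ≫ (smodMap Φ').map ((smodMapIso Φ).inv.app X) :=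
  congr(NatTrans.app (Iso.hom $((exists_smodMapComp Φ Φ').choose_spec)) X)

lemma smodMapComp_inv_app (Φ : E ⟶ E') (Φ' : E' ⟶ E'') (X : E.cat.carrier) :
    (smodMapComp Φ Φ').inv.app ((yonedaAdm _).obj X) =
      (smodMap Φ').map ((smodMapIso Φ).hom.app X) ≫
        (smodMapIso Φ').hom.app ((functor Φ).obj X) ≫ (smodMapIso (Φ ≫ Φ')).inv.app X := by
  have h := congr(NatTrans.app (Iso.inv $((exists_smodMapComp Φ Φ').choose_spec)) X)
  exact h.trans (Category.assoc _ _ _)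

lemma smodMapIso_map_inv_hom (Φ : E ⟶ E') (X : E.cat.carrier) {C : Type*} [Category* C]
    (F : SmodAdm E'.cat.carrier ⥤ C) {T : C}
    (h : F.obj ((yonedaAdm _).obj ((functor Φ).obj X)) ⟶ T) :
    F.map ((smodMapIso Φ).inv.app X) ≫ F.map ((smodMapIso Φ).hom.app X) ≫ h = h := by
  rw [← Category.assoc, ← F.map_comp, Iso.inv_hom_id_app]
  simp

lemma smodMapIso_inv_naturality_assoc (Φ : E ⟶ E') {X X' : E.cat.carrier} (b : X ⟶ X')
    {T : SmodAdm E'.cat.carrier} (h : (smodMap Φ).obj ((yonedaAdm _).obj X') ⟶ T) :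
    (smodMapIso Φ).inv.app X ≫ (smodMap Φ).map ((yonedaAdm _).map b) ≫ h =
      (yonedaAdm _).map ((functor Φ).map b) ≫ (smodMapIso Φ).inv.app X' ≫ h := by
  have := (smodMapIso Φ).inv.naturality b
  simp only [Functor.comp_map] at this
  rw [reassoc_of% this]

/-- Components at the values of `smodMap Φ` in terms of components at representable functors. -/
lemma app_smodMap_obj (Φ : E ⟶ E') {C : Type*} [Category* C] {F G : SmodAdm E'.cat.carrier ⥤ C}
    (σ : F ⟶ G) (X : E.cat.carrier) :
    σ.app ((smodMap Φ).obj ((yonedaAdm _).obj X)) = F.map ((smodMapIso Φ).hom.app X) ≫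
      σ.app ((yonedaAdm _).obj ((functor Φ).obj X)) ≫ G.map ((smodMapIso Φ).inv.app X) := by
  have h := σ.naturality ((smodMapIso Φ).hom.app X)
  have h' := congr(G.map $((smodMapIso Φ).hom_inv_id_app X))
  simp only [Functor.comp_obj, G.map_comp, G.map_id] at h h'
  rw [reassoc_of% h, h', Category.comp_id]

end

/-- The 1-morphism `smodMap Φ` of `Ex`. -/
noncomputable abbrev smodHom {E E' : ExL.{w}} (Φ : E ⟶ E') : smodObj E ⟶ smodObj E' :=
  ofFunctor (smodMap Φ) (isExactFunctor_smodMap Φ)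

/-- The 2-functor `mod_adm(-)`. -/
noncomputable def smodPseudofunctor : Pseudofunctor ExL.{w} Ex.{w} where
  obj E := smodObj E
  map Φ := smodHom Φ
  map₂ η := homMk (smodMap₂ η)
  mapId E := ExactBicat.isoMk (F := smodHom (𝟙 E)) (G := 𝟙 (smodObj E)) (smodMapId E)
  mapComp Φ Φ' := ExactBicat.isoMk (F := smodHom (Φ ≫ Φ')) (G := smodHom Φ ≫ smodHom Φ')
    (smodMapComp Φ Φ')
  map₂_id Φ := smodObj_hom₂_ext fun X => by
    refine (smodMap₂_app (𝟙 Φ) X).trans ?_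
    change _ ≫ (yonedaAdm _).map (𝟙 _) ≫ _ = 𝟙 _
    rw [(yonedaAdm _).map_id, Category.id_comp]
    exact Iso.hom_inv_id_app _ _
  map₂_comp η η' := smodObj_hom₂_ext fun X => by
    refine (smodMap₂_app (η ≫ η') X).trans ?_
    change _ = (smodMap₂ η).app _ ≫ (smodMap₂ η').app _
    rw [smodMap₂_app, smodMap₂_app]
    change _ ≫ (yonedaAdm _).map (_ ≫ _) ≫ _ = _
    simp
  map₂_whisker_left Φ Φ' Φ'' η := smodObj_hom₂_ext fun X => by
    refine (smodMap₂_app (Φ ◁ η) X).trans ?_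
    change _ = (smodMapComp Φ Φ').hom.app _ ≫ (smodMap₂ η).app _ ≫ (smodMapComp Φ Φ'').inv.app _
    rw [smodMapComp_hom_app, smodMapComp_inv_app, app_smodMap_obj, smodMap₂_app]
    simp only [Category.assoc, smodMapIso_map_inv_hom, Iso.inv_hom_id_app_assoc]
    rfl
  map₂_whisker_right {_ _ _ Φ Φ'} η Φ'' := smodObj_hom₂_ext fun X => by
    refine (smodMap₂_app (η ▷ Φ'') X).trans ?_
    change _ = (smodMapComp Φ Φ'').hom.app _ ≫ (smodMap Φ'').map ((smodMap₂ η).app _) ≫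
      (smodMapComp Φ' Φ'').inv.app _
    rw [smodMapComp_hom_app, smodMapComp_inv_app, smodMap₂_app]
    simp only [CategoryTheory.Functor.map_comp, Category.assoc, smodMapIso_map_inv_hom,
      smodMapIso_inv_naturality_assoc, Iso.inv_hom_id_app_assoc]
    rfl
  map₂_associator Φ Φ' Φ'' := smodObj_hom₂_ext fun X => by
    refine (smodMap₂_app (α_ Φ Φ' Φ'').hom X).trans ?_
    change _ = (smodMapComp (Φ ≫ Φ') Φ'').hom.app _ ≫
      (smodMap Φ'').map ((smodMapComp Φ Φ').hom.app _) ≫ 𝟙 _ ≫ (smodMapComp Φ' Φ'').inv.app _ ≫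
      (smodMapComp Φ (Φ' ≫ Φ'')).inv.app _
    rw [smodMapComp_hom_app, smodMapComp_hom_app, app_smodMap_obj, smodMapComp_inv_app,
      smodMapComp_inv_app]
    simp only [CategoryTheory.Functor.map_comp, Category.assoc, smodMapIso_map_inv_hom]
    change _ ≫ (yonedaAdm _).map (𝟙 _) ≫ _ = _
    simp only [CategoryTheory.Functor.map_id, Category.id_comp]
    -- After expansion the two sides differ by inverse pairs of `smodMapIso Φ` and `smodMapIso Φ'`,
    -- seen through the functors applied afterwards; `h₁` and `h₂` cancel them.
    have h₁ {T} := smodMapIso_map_inv_hom Φ X (smodMap Φ' ⋙ smodMap Φ'') (T := T)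
    have h₂ {T} := smodMapIso_map_inv_hom Φ' ((functor Φ).obj X) (smodMap Φ'') (T := T)
    refine congr(_ ≫ $(Eq.symm ?_))
    refine congr((smodMapIso Φ'').inv.app _ ≫ (smodMap Φ'').map _ ≫ $(h₁ _)).trans ?_
    refine congr((smodMapIso Φ'').inv.app _ ≫ $(h₂ _)).trans ?_
    simp
  map₂_left_unitor Φ := smodObj_hom₂_ext fun X => by
    refine (smodMap₂_app (λ_ Φ).hom X).trans ?_
    change _ = (smodMapComp (𝟙 _) Φ).hom.app _ ≫ (smodMap Φ).map ((smodMapId _).hom.app _) ≫ 𝟙 _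
    rw [smodMapComp_hom_app, smodMapId_hom_app]
    change _ ≫ (yonedaAdm _).map (𝟙 _) ≫ _ = _
    simp only [CategoryTheory.Functor.map_id, Category.id_comp, Category.assoc]
    refine congr(_ ≫ $(Eq.symm ?_))
    have h := smodMapIso_map_inv_hom (𝟙 _) X (smodMap Φ) (𝟙 _)
    exact congr((smodMapIso Φ).inv.app _ ≫ $h).trans (Category.comp_id _)
  map₂_right_unitor Φ := smodObj_hom₂_ext fun X => by
    refine (smodMap₂_app (ρ_ Φ).hom X).trans ?_
    change _ = (smodMapComp Φ (𝟙 _)).hom.app _ ≫ (smodMapId _).hom.app _ ≫ 𝟙 _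
    rw [smodMapComp_hom_app, app_smodMap_obj, smodMapId_hom_app]
    change _ ≫ (yonedaAdm _).map (𝟙 _) ≫ _ = _
    simp only [CategoryTheory.Functor.map_id, Category.id_comp, Category.assoc,
      smodMapIso_map_inv_hom, Iso.inv_hom_id_app_assoc]
    exact congr(_ ≫ $((Category.comp_id _).symm))

end Pseudofunctor

/-! ### The unit and the equivalence given by restriction. -/

section Adjunction

open ExactBicat Bicategory

/-- The Yoneda embeddings as a pseudonatural transformation. -/
noncomputable def yonedaStrongTrans : Pseudofunctor.StrongTrans (Pseudofunctor.id ExL.{w})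
    (smodPseudofunctor.comp exInclusion.{w}) where
  app E := yonedaHom E isExactCategory_smodAdm (isLeftExactFunctor_yonedaAdm _)
  -- With the inverse of `smodMapIso` as naturality constraint, the laws below are the formulas that
  -- define `smodMap₂`, `smodMapId` and `smodMapComp` on representables.
  naturality {E E'} Φ := ExactBicat.isoMk
    (F := Φ ≫ yonedaHom E' isExactCategory_smodAdm (isLeftExactFunctor_yonedaAdm _))
    (G := yonedaHom E isExactCategory_smodAdm (isLeftExactFunctor_yonedaAdm _) ≫
      exInclusion.map (smodHom Φ)) (smodMapIso Φ).symm
  naturality_naturality {E E' Φ Φ'} η := hom₂_ext fun (X : E.cat.carrier) => by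
    change (yonedaAdm _).map ((natTrans η).app X) ≫ (smodMapIso Φ').inv.app X =
      (smodMapIso Φ).inv.app X ≫ (smodMap₂ η).app ((yonedaAdm _).obj X)
    rw [smodMap₂_app, Iso.inv_hom_id_app_assoc]
  naturality_id E := hom₂_ext fun (X : E.cat.carrier) => by
    change (smodMapIso (𝟙 E)).inv.app X ≫ (smodMapId E).hom.app ((yonedaAdm _).obj X) ≫ 𝟙 _ =
      (yonedaAdm _).map (𝟙 _) ≫ 𝟙 _ ≫ 𝟙 _
    rw [smodMapId_hom_app]
    refine ((smodMapIso (𝟙 E)).inv_hom_id_app_assoc X (𝟙 _)).trans ?_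
    simp only [CategoryTheory.Functor.map_id, Category.id_comp]
    rfl
  naturality_comp {E E' E''} Φ Φ' := hom₂_ext fun (X : E.cat.carrier) => by
    change (smodMapIso (Φ ≫ Φ')).inv.app X ≫
      (smodMapComp Φ Φ').hom.app ((yonedaAdm _).obj X) ≫ 𝟙 _ =
      (yonedaAdm _).map (𝟙 _) ≫ 𝟙 _ ≫ (smodMapIso Φ').inv.app ((functor Φ).obj X) ≫ 𝟙 _ ≫
        (smodMap Φ').map ((smodMapIso Φ).inv.app X) ≫ 𝟙 _
    rw [smodMapComp_hom_app, Category.assoc, Iso.inv_hom_id_app_assoc]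
    simp only [CategoryTheory.Functor.map_id, Category.id_comp]
    exact Category.assoc _ _ _

/-- Full faithfulness is the unique extension of natural transformations from representables;
essential surjectivity is the extension of left exact functors. -/
instance isEquivalence_restriction (E : ExL.{w}) (E' : Ex.{w}) :
    (restriction (yonedaHom E isExactCategory_smodAdm (isLeftExactFunctor_yonedaAdm _))
      E').IsEquivalence where
  faithful := ⟨fun {Ψ Ψ' σ τ} h => smodObj_hom₂_ext fun X =>
    congr(NatTrans.app (natTrans $h) X)⟩
  full := ⟨fun {Ψ Ψ'} γ => by
    obtain ⟨δ, hδ⟩ := (ObjectProperty.FullSubcategory.property Ψ).exists_natTrans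
      (ObjectProperty.FullSubcategory.property Ψ').additive (natTrans γ)
    exact ⟨homMk δ, hom₂_ext fun X => congr(NatTrans.app $hδ X)⟩⟩
  essSurj := ⟨fun Φ =>
    have hΦ := ObjectProperty.FullSubcategory.property Φ
    ⟨ofFunctor hΦ.extension hΦ.isExactFunctor_extension, ⟨ExactBicat.isoMk hΦ.extensionIso⟩⟩⟩

end Adjunction

end AdmPres

/-! ### The theorem and its corollary. -/

theorem mainTheorem6 :
    (∀ (E : Type u) [Category.{v} E] [Preadditive E] [AdmPres.ConflationCategory E]
        [AdmPres.IsExactCategory E],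
      AdmPres.IsExactCategory (AdmPres.SmodAdm E) ∧
      AdmPres.IsLeftExactFunctor (AdmPres.yonedaAdm E) ∧
      ∀ (F : Type u') [Category.{v'} F] [Preadditive F] [AdmPres.ConflationCategory F]
        [AdmPres.IsExactCategory F] (Φ : E ⥤ F), AdmPres.IsLeftExactFunctor Φ →
        (∃ Ψ : AdmPres.SmodAdm E ⥤ F, AdmPres.IsExactFunctor Ψ ∧
          Nonempty (AdmPres.yonedaAdm E ⋙ Ψ ≅ Φ)) ∧
        (∀ Ψ Ψ' : AdmPres.SmodAdm E ⥤ F,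
          AdmPres.IsExactFunctor Ψ → AdmPres.IsExactFunctor Ψ' →
          ∀ (α : AdmPres.yonedaAdm E ⋙ Ψ ≅ Φ) (α' : AdmPres.yonedaAdm E ⋙ Ψ' ≅ Φ),
            ∃! β : Ψ ≅ Ψ', Functor.isoWhiskerLeft (AdmPres.yonedaAdm E) β ≪≫ α' = α) ∧
        (Function.Injective (AdmPres.yonedaAdm E).obj →
          ∃ Ψ : AdmPres.SmodAdm E ⥤ F, AdmPres.IsExactFunctor Ψ ∧
            AdmPres.yonedaAdm E ⋙ Ψ = Φ)) ∧
    (∃ (hex : ∀ E : AdmPres.ExL.{w}, AdmPres.IsExactCategory (AdmPres.SmodAdm E.cat.carrier))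
      (hY : ∀ E : AdmPres.ExL.{w},
        AdmPres.IsLeftExactFunctor (AdmPres.yonedaAdm E.cat.carrier))
      (S : Pseudofunctor AdmPres.ExL.{w} AdmPres.Ex.{w})
      (hS : ∀ E : AdmPres.ExL.{w}, S.obj E = AdmPres.smodAdmObj E (hex E))
      (η : Pseudofunctor.StrongTrans (Pseudofunctor.id AdmPres.ExL.{w})
        (S.comp AdmPres.exInclusion.{w})),
      ∀ E : AdmPres.ExL.{w},
        η.app E ≫ AdmPres.exInclusion.{w}.map (eqToHom (hS E)) =
          AdmPres.yonedaHom E (hex E) (hY E) ∧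
        ∀ E' : AdmPres.Ex.{w},
          (AdmPres.restriction (AdmPres.yonedaHom E (hex E) (hY E)) E').IsEquivalence) := by
  refine ⟨fun E _ _ _ _ => ⟨inferInstance, AdmPres.isLeftExactFunctor_yonedaAdm E,
    fun F _ _ _ _ Φ hΦ => ⟨⟨hΦ.extension, hΦ.isExactFunctor_extension, ⟨hΦ.extensionIso⟩⟩,
      fun Ψ Ψ' hΨ hΨ' α α' => hΨ.existsUnique_natIso hΨ' α α', fun hy => ?_⟩⟩,
    fun _ => AdmPres.isExactCategory_smodAdm, fun _ => AdmPres.isLeftExactFunctor_yonedaAdm _,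
    -- The pseudofunctor has the prescribed values on objects by definition, so the `eqToHom` is an
    -- identity and the unit is the Yoneda embedding by `rfl`.
    AdmPres.smodPseudofunctor, fun _ => rfl, AdmPres.yonedaStrongTrans, fun E => ⟨rfl, fun E' =>
      AdmPres.isEquivalence_restriction E E'⟩⟩
  -- Strict case: correct the extension on objects within its isomorphism class; exactness is
  -- invariant under isomorphism.
  obtain ⟨Ψ, ⟨e⟩, h⟩ := AdmPres.exists_iso_comp_eq hy hΦ.extensionIso
  exact ⟨Ψ, hΦ.isExactFunctor_extension.of_iso e, h⟩
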